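/- Let $\mu,\lambda\ge 0$ be finite (regular) Borel measures on the unit circle $\partial\mathbb D$; inner products and forms are conjugate linear in the first argument. Let $A(\mathbb D)$ be the disk algebra, and for $z\in\mathbb D$ let $k_z(\zeta)=(1-\bar z\zeta)^{-1}\in A(\mathbb D)$. Let $H^2(\mu)$ be the closure of the analytic polynomials in $L^2(\mu)$, and let $\mathscr H^+(\mu)$ be the Hilbert space of the functions $(\mathscr C_\mu h)(z)=\int_{\partial\mathbb D}\frac{h(\zeta)}{1-z\bar\zeta}\,\mu(d\zeta)=\langle k_z,h\rangle_{L^2(\mu)}$ on $\mathbb D$, $h\in H^2(\mu)$, with $\langle \mathscr C_\mu g,\mathscr C_\mu h\rangle_\mu=\langle g,h\rangle_{L^2(\mu)}$, so that $\mathscr C_\mu:H^2(\mu)\to\mathscr H^+(\mu)$ is unitary. Put $\mathrm{int}(\mu,\lambda)=\mathscr H^+(\mu)\cap\mathscr H^+(\lambda)$ (intersection of sets of functions), and let $\mathrm{int}(\mu,\lambda)^{-\mu}$ be its closure in $\mathscr H^+(\mu)$. Let $\mathfrak q_\mu(g,h)=\int_{\partial\mathbb D}\bar g h\,d\mu$,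 $g,h\in A(\mathbb D)$, regarded as a positive semi-definite form in $H^2(\lambda)$ with dense form domain $A(\mathbb D)$ through the canonical map $A(\mathbb D)\to H^2(\lambda)$ (which need not be injective). A densely defined positive semi-definite form $\mathfrak t$ in $H^2(\lambda)$ is closed if $\mathrm{Dom}\,\mathfrak t$ is complete for the norm $(\|x\|^2+\mathfrak t(x,x))^{1/2}$; it extends a form $\mathfrak q$ if the image of $\mathrm{Dom}\,\mathfrak q$ lies in $\mathrm{Dom}\,\mathfrak t$ and $\mathfrak t$ agrees with $\mathfrak q$ there; $\mathfrak q$ is closeable if it has a closed extension, and the smallest closed extension is its closure $\overline{\mathfrak q}$. Write $\mathfrak p\le\mathfrak q$ if (the image of) $\mathrm{Dom}\,\mathfrak q$ is contained in $\mathrm{Dom}\,\mathfrak p$ and $\mathfrak p(x,x)\le\mathfrak q(x,x)$ for all $x\in\mathrm{Dom}\,\mathfrak q$. Then $\mathfrak q_\mu$ has a unique Simon–Lebesgue decomposition $\mathfrak q_\mu=\mathfrak q_{ac}+\mathfrak q_s$ into positive semi-definite forms on $A(\mathbb D)$ such that $\mathfrak q_{ac}$ is closeable and is the largest closeable positive form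 $\le\mathfrak q_\mu$, and $\mathfrak q_s$ is singular, i.e. the only closeable positive form $\le\mathfrak q_s$ is $0$. Let $H^2(\mathfrak q_{ac})$ be the Hilbert space completion of $A(\mathbb D)$, modulo vectors of length zero, for the semi-inner product $\mathfrak q_{ac}$, and let $\mathscr H^+(\mathfrak q_{ac})$ be the Hilbert space of the functions $(\mathscr C_{ac}h)(z)=\langle k_z,h\rangle_{H^2(\mathfrak q_{ac})}$, $h\in H^2(\mathfrak q_{ac})$, with $\langle\mathscr C_{ac}g,\mathscr C_{ac}h\rangle_{ac}=\langle g,h\rangle_{H^2(\mathfrak q_{ac})}$. Then $$\mathscr H^+(\mathfrak q_{ac})=\mathrm{int}(\mu,\lambda)^{-\mu}=\bigl(\mathscr H^+(\mu)\cap\mathscr H^+(\lambda)\bigr)^{-\|\cdot\|_\mu}$$ as Hilbert spaces of functions on $\mathbb D$ (same functions, same inner product). Moreover, let $\mathrm e:\mathrm{int}(\mu,\lambda)\to\mathscr H^+(\lambda)$, $\mathrm e f=f$, be regarded as a densely defined operator from the Hilbert space $\mathrm{int}(\mu,\lambda)^{-\mu}\subseteq\mathscr H^+(\mu)$ into $\mathscr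 H^+(\lambda)$. Then $\mathrm e$ is closed, the operator $$D=\mathscr C_\lambda^*\,\mathrm e\,\mathrm e^*\,\mathscr C_\lambda,$$ on its natural domain in $H^2(\lambda)$, is densely defined, self-adjoint and positive semi-definite, and $\overline{\mathfrak q_{ac}}=\mathfrak q_D$, where $\mathrm{Dom}\,\mathfrak q_D=\mathrm{Dom}\sqrt D$ and $\mathfrak q_D(x,y)=\langle\sqrt D x,\sqrt D y\rangle_{H^2(\lambda)}$. -/

import Mathlib

open MeasureTheory Metric Filter Topology InnerProductSpace
open scoped ComplexOrder ComplexConjugate Complex.UnitDisc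

namespace CauchyForms

noncomputable section

/-! ### Positive semi-definite forms in a Hilbert space -/

/-- A positive semi-definite sesquilinear form on a complex vector space `V`, conjugate linear in
the first and linear in the second argument. -/
structure PSForm (V : Type*) [AddCommGroup V] [Module ℂ V] where
  toFun : V →ₗ⋆[ℂ] V →ₗ[ℂ] ℂ
  isPosSemidef : toFun.IsPosSemidef

instance {V : Type*} [AddCommGroup V] [Module ℂ V] :
    CoeFun (PSForm V) (fun _ => V → V → ℂ) :=
  ⟨fun q x y => q.toFun x y⟩

/-- A densely defined positive semi-definite form in a Hilbert space `H`. -/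
structure DenseForm (H : Type*) [NormedAddCommGroup H] [InnerProductSpace ℂ H] where
  dom : Submodule ℂ H
  dense_dom : Dense (dom : Set H)
  form : PSForm dom

section Forms

variable {H : Type*} [NormedAddCommGroup H] [InnerProductSpace ℂ H]
variable {V : Type*} [AddCommGroup V] [Module ℂ V]

/-- A form `t` is closed if its domain is complete for the norm
`‖x‖² + t(x, x)`: Cauchy sequences for this norm converge in this norm. -/
def DenseForm.IsClosed (t : DenseForm H) : Prop :=
  ∀ u : ℕ → t.dom,
    (∀ ε : ℝ, 0 < ε → ∃ N, ∀ m, N ≤ m → ∀ n, N ≤ n →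
      ‖u m - u n‖ ^ 2 + (t.form (u m - u n) (u m - u n)).re < ε) →
    ∃ x : t.dom, Tendsto (fun n => ‖u n - x‖ ^ 2 + (t.form (u n - x) (u n - x)).re) atTop (𝓝 0)

/-- A form `q` on a vector space `V` which is mapped into `H` by `ι` is regarded as a form in `H`
with form domain `V`. If `ι` is the inclusion of a subspace, this is a form whose domain is that
subspace. The form `t` in `H` extends `q` if its domain contains the image of `V`
and `t(ι v, ι w) = q(v, w)`. -/
def DenseForm.Extends (t : DenseForm H) (ι : V →ₗ[ℂ] H) (q : PSForm V) : Prop :=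
  ∃ h : ∀ v, ι v ∈ t.dom, ∀ v w, t.form ⟨ι v, h v⟩ ⟨ι w, h w⟩ = q v w

/-- `q` is closeable (absolutely continuous) in `H` if it has a closed extension. -/
def IsCloseable (ι : V →ₗ[ℂ] H) (q : PSForm V) : Prop :=
  ∃ t : DenseForm H, t.IsClosed ∧ t.Extends ι q

/-- `t` is the closure of `q`: the smallest closed extension. -/
def DenseForm.IsClosureOf (t : DenseForm H) (ι : V →ₗ[ℂ] H) (q : PSForm V) : Prop :=
  t.IsClosed ∧ t.Extends ι q ∧
    ∀ s : DenseForm H, s.IsClosed → s.Extends ι q → s.Extends t.dom.subtype t.form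

/-- The order `p ≤ q` of forms: the domain of `q` is contained in that of `p`,
and `p(x, x) ≤ q(x, x)` for `x` in the domain of `q`. -/
def DenseForm.LE (p : DenseForm H) (ι : V →ₗ[ℂ] H) (q : PSForm V) : Prop :=
  ∃ h : ∀ v, ι v ∈ p.dom, ∀ v, p.form ⟨ι v, h v⟩ ⟨ι v, h v⟩ ≤ q v v

/-- `q = qac + qs` is the Simon–Lebesgue decomposition of the form `q` in `H`, with form domain `V`:
`qac` is closeable, and it is the largest closeable form below `q`, and `qs` is singular, that is,
the only closeable form below it is zero.
(That `qac ≤ q` and `qs ≤ q` holds because both forms are positive.) -/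
structure IsSimonLebesgue (ι : V →ₗ[ℂ] H) (q qac qs : PSForm V) : Prop where
  add_eq : ∀ v w, q v w = qac v w + qs v w
  closeable : IsCloseable ι qac
  maximal : ∀ p : DenseForm H, IsCloseable p.dom.subtype p.form → p.LE ι q → p.LE ι qac
  singular : ∀ p : DenseForm H, IsCloseable p.dom.subtype p.form → p.LE ι qs →
    ∀ x y, p.form x y = 0

theorem IsSimonLebesgue.ac_le {ι : V →ₗ[ℂ] H} {q qac qs : PSForm V}
    (h : IsSimonLebesgue ι q qac qs) (v : V) : qac v v ≤ q v v := by
  rw [h.add_eq v v]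
  exact le_add_of_nonneg_right (qs.isPosSemidef.isNonneg.nonneg v)

end Forms

/-! ### Unbounded operators -/

/-- The product `B A` of unbounded operators on its natural domain
`{x ∈ Dom A | A x ∈ Dom B}`. -/
def opComp {E F G : Type*} [AddCommGroup E] [Module ℂ E] [AddCommGroup F] [Module ℂ F]
    [AddCommGroup G] [Module ℂ G] (B : F →ₗ.[ℂ] G) (A : E →ₗ.[ℂ] F) : E →ₗ.[ℂ] G where
  domain := (B.domain.comap A.toFun).map A.domain.subtype
  toFun := B.toFun ∘ₗ
    (A.toFun ∘ₗ Submodule.inclusion (Submodule.map_subtype_le _ _)).codRestrict B.domain (by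
      rintro ⟨_, x, hx, rfl⟩
      exact hx)

theorem mem_opComp_domain {E F G : Type*} [AddCommGroup E] [Module ℂ E] [AddCommGroup F]
    [Module ℂ F] [AddCommGroup G] [Module ℂ G] (B : F →ₗ.[ℂ] G) (A : E →ₗ.[ℂ] F) (x : E) :
    x ∈ (opComp B A).domain ↔ ∃ h : x ∈ A.domain, A ⟨x, h⟩ ∈ B.domain := by
  constructor
  · rintro ⟨y, hy, rfl⟩
    exact ⟨y.2, hy⟩
  · rintro ⟨h, hx⟩
    exact ⟨⟨x, h⟩, hx, rfl⟩

theorem opComp_apply {E F G : Type*} [AddCommGroup E] [Module ℂ E] [AddCommGroup F]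
    [Module ℂ F] [AddCommGroup G] [Module ℂ G] (B : F →ₗ.[ℂ] G) (A : E →ₗ.[ℂ] F)
    (x : E) (h : x ∈ A.domain) (h' : A ⟨x, h⟩ ∈ B.domain) (hx : x ∈ (opComp B A).domain) :
    opComp B A ⟨x, hx⟩ = B ⟨A ⟨x, h⟩, h'⟩ := rfl

section Operators

variable {H : Type*} [NormedAddCommGroup H] [InnerProductSpace ℂ H] [CompleteSpace H]

/-- Densely defined, self-adjoint and positive semi-definite operators. -/
structure IsPosSelfAdjoint (A : H →ₗ.[ℂ] H) : Prop where
  dense_domain : Dense (A.domain : Set H)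
  adjoint_eq : A.adjoint = A
  nonneg : ∀ x : A.domain, 0 ≤ ⟪(x : H), A x⟫_ℂ

/-- `t` is the form `q_A` of the positive self-adjoint operator `A`, that is, `Dom t = Dom √A` and
`t(x, y) = ⟪√A x, √A y⟫`. The operator `S` below is the positive square root `√A`. -/
def DenseForm.IsFormOf (t : DenseForm H) (A : H →ₗ.[ℂ] H) : Prop :=
  IsPosSelfAdjoint A ∧
    ∃ S : H →ₗ.[ℂ] H, IsPosSelfAdjoint S ∧ opComp S S = A ∧
      ∃ h : t.dom = S.domain, ∀ x y : t.dom,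
        t.form x y = ⟪S ⟨x, h ▸ x.2⟩, S ⟨y, h ▸ y.2⟩⟫_ℂ

end Operators

/-! ### The disk algebra and its Szegő kernels -/

/-- The unit circle. -/
abbrev circ : Type := sphere (0 : ℂ) 1

/-- The disk algebra `A(𝔻)`, with the supremum norm: continuous functions on the closed unit disk
which are analytic in the open disk. -/
def diskAlgebra : Submodule ℂ C(closedBall (0 : ℂ) 1, ℂ) where
  carrier := {f | ∃ F : ℂ → ℂ, DifferentiableOn ℂ F (ball 0 1) ∧
    ∀ z : closedBall (0 : ℂ) 1, (z : ℂ) ∈ ball (0 : ℂ) 1 → F z = f z}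
  add_mem' := by
    rintro f g ⟨F, hF, hFf⟩ ⟨G, hG, hGg⟩
    exact ⟨F + G, hF.add hG, fun z hz => by simp [hFf z hz, hGg z hz]⟩
  zero_mem' := ⟨0, differentiableOn_const 0, fun z hz => by simp⟩
  smul_mem' := by
    rintro c f ⟨F, hF, hFf⟩
    exact ⟨c • F, hF.const_smul c, fun z hz => by simp [hFf z hz]⟩

/-- Boundary values `A(𝔻) → C(∂𝔻)`. -/
def boundary : diskAlgebra →L[ℂ] C(circ, ℂ) :=
  LinearMap.mkContinuous
    { toFun := fun f => (f : C(closedBall (0 : ℂ) 1, ℂ)).comp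
        ⟨fun ζ => ⟨(ζ : ℂ), sphere_subset_closedBall ζ.2⟩, by fun_prop⟩
      map_add' := fun f g => rfl
      map_smul' := fun c f => rfl } 1 (by
    intro f
    rw [one_mul]
    refine (ContinuousMap.norm_le _ (norm_nonneg _)).2 fun ζ => ?_
    exact (f : C(closedBall (0 : ℂ) 1, ℂ)).norm_coe_le_norm _)

theorem boundary_apply (f : diskAlgebra) (ζ : circ) :
    boundary f ζ =
      (f : C(closedBall (0 : ℂ) 1, ℂ)) ⟨(ζ : ℂ), sphere_subset_closedBall ζ.2⟩ := rfl

/-- The monomial `ζ ^ n` as an element of the disk algebra. -/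
def mono (n : ℕ) : diskAlgebra :=
  ⟨⟨fun w => (w : ℂ) ^ n, by fun_prop⟩, fun w => w ^ n, by fun_prop, fun _ _ => rfl⟩

theorem one_sub_ne_zero {z w : ℂ} (hz : ‖z‖ < 1) (hw : ‖w‖ ≤ 1) : 1 - conj z * w ≠ 0 := by
  intro h
  have h1 : conj z * w = 1 := (sub_eq_zero.1 h).symm
  have h2 : ‖conj z * w‖ < 1 := by
    rw [norm_mul, RCLike.norm_conj]
    calc ‖z‖ * ‖w‖ ≤ ‖z‖ * 1 := by gcongr
      _ < 1 := by simpa using hz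
  rw [h1] at h2
  simp at h2

/-- The Szegő kernel vector `k_z(ζ) = (1 - z̄ ζ)⁻¹`, an element of the disk algebra. -/
def szego (z : 𝔻) : diskAlgebra :=
  ⟨⟨fun w => (1 - conj (z : ℂ) * (w : ℂ))⁻¹, by
      refine Continuous.inv₀ (by fun_prop) fun w => ?_
      exact one_sub_ne_zero z.norm_lt_one (mem_closedBall_zero_iff.1 w.2)⟩,
    fun w => (1 - conj (z : ℂ) * w)⁻¹, by
      refine DifferentiableOn.inv (by fun_prop) fun w hw => ?_
      exact one_sub_ne_zero z.norm_lt_one (mem_ball_zero_iff.1 hw).le,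
    fun _ _ => rfl⟩

theorem norm_mono_le (n : ℕ) : ‖mono n‖ ≤ 1 := by
  refine (ContinuousMap.norm_le _ zero_le_one).2 fun w => ?_
  have : ‖(w : ℂ)‖ ≤ 1 := mem_closedBall_zero_iff.1 w.2
  change ‖(w : ℂ) ^ n‖ ≤ 1
  rw [norm_pow]
  exact pow_le_one₀ (norm_nonneg _) this

theorem hasSum_szego (z : 𝔻) : HasSum (fun n => (conj (z : ℂ)) ^ n • mono n) (szego z) := by
  have hind : IsInducing (diskAlgebra.subtype : diskAlgebra → C(closedBall (0 : ℂ) 1, ℂ)) :=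
    IsInducing.subtypeVal
  rw [← hind.hasSum_iff (g := diskAlgebra.subtype)]
  have hs : Summable (fun n => diskAlgebra.subtype ((conj (z : ℂ)) ^ n • mono n)) := by
    refine Summable.of_norm_bounded (g := fun n => ‖(z : ℂ)‖ ^ n)
      (summable_geometric_of_lt_one (norm_nonneg _) z.norm_lt_one) fun n => ?_
    change ‖(conj (z : ℂ)) ^ n • mono n‖ ≤ _
    rw [norm_smul, norm_pow, RCLike.norm_conj]
    exact mul_le_of_le_one_right (by positivity) (norm_mono_le n)
  have h := hs.hasSum
  convert! h using 1
  ext w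
  have hw : ‖(w : ℂ)‖ ≤ 1 := mem_closedBall_zero_iff.1 w.2
  have h1 := ContinuousMap.hasSum_apply h w
  have hlt : ‖conj (z : ℂ) * (w : ℂ)‖ < 1 := by
    rw [norm_mul, RCLike.norm_conj]
    calc ‖(z : ℂ)‖ * ‖(w : ℂ)‖ ≤ ‖(z : ℂ)‖ * 1 := by gcongr
      _ < 1 := by simpa using z.norm_lt_one
  have h2 := hasSum_geometric_of_norm_lt_one hlt
  refine HasSum.unique ?_ h1
  convert! h2 using 1
  funext n
  change (conj (z : ℂ)) ^ n * (w : ℂ) ^ n = _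
  rw [mul_pow]

/-- Polynomials are dense in the disk algebra. -/
theorem span_mono_dense : (Submodule.span ℂ (Set.range mono)).topologicalClosure = ⊤ := by
  rw [Submodule.eq_top_iff']
  rintro ⟨f, F, hF, hFf⟩
  refine Metric.mem_closure_iff.2 fun ε hε => ?_
  have hfu : UniformContinuous f := CompactSpace.uniformContinuous_of_continuous f.continuous
  obtain ⟨δ, hδ, hfδ⟩ := Metric.uniformContinuous_iff.1 hfu (ε / 4) (by positivity)
  obtain ⟨r, hr0, hr1, hrδ⟩ : ∃ r : ℝ, 0 < r ∧ r < 1 ∧ 1 - r < δ :=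
    ⟨max (1 / 2) (1 - δ / 2), by positivity, by
      refine max_lt (by norm_num) (by linarith), by
      have := le_max_right (1 / 2 : ℝ) (1 - δ / 2)
      linarith⟩
  let R : NNReal := ⟨(r + 2) / 3, by positivity⟩
  let R' : NNReal := ⟨(2 * r + 1) / 3, by positivity⟩
  have hR : (R : ℝ) = (r + 2) / 3 := rfl
  have hR' : (R' : ℝ) = (2 * r + 1) / 3 := rfl
  have hd : DifferentiableOn ℂ F (closedBall 0 R) :=
    hF.mono (closedBall_subset_ball (by rw [hR]; linarith))
  have hps := hd.hasFPowerSeriesOnBall (NNReal.coe_pos.1 (by rw [hR]; linarith))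
  have hu := hps.tendstoUniformlyOn (r' := R')
    (ENNReal.coe_lt_coe.2 (NNReal.coe_lt_coe.1 (by rw [hR, hR']; linarith)))
  obtain ⟨n, hn⟩ := (Metric.tendstoUniformlyOn_iff.1 hu (ε / 4) (by positivity)).exists
  set p := cauchyPowerSeries F 0 R with hp
  refine ⟨∑ k ∈ Finset.range n, ((r : ℂ) ^ k * p.coeff k) • mono k,
    Submodule.sum_mem _ fun k _ => Submodule.smul_mem _ _ (Submodule.subset_span ⟨k, rfl⟩), ?_⟩
  refine lt_of_le_of_lt (b := ε / 2) ?_ (by linarith)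
  change dist f ((∑ k ∈ Finset.range n, ((r : ℂ) ^ k * p.coeff k) • mono k : diskAlgebra) :
    C(closedBall (0 : ℂ) 1, ℂ)) ≤ ε / 2
  refine (ContinuousMap.dist_le (by positivity)).2 fun w => ?_
  have hw : ‖(w : ℂ)‖ ≤ 1 := mem_closedBall_zero_iff.1 w.2
  have hrw : ‖(r : ℂ) * w‖ ≤ r := by
    rw [norm_mul, Complex.norm_real, Real.norm_of_nonneg hr0.le]
    exact mul_le_of_le_one_right hr0.le hw
  let w' : closedBall (0 : ℂ) 1 := ⟨(r : ℂ) * w, mem_closedBall_zero_iff.2 (hrw.trans hr1.le)⟩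
  have h1 : dist (f w) (f w') < ε / 4 := by
    refine hfδ ?_
    rw [Subtype.dist_eq, dist_eq_norm]
    have : (w : ℂ) - (w' : ℂ) = ((1 - r : ℝ) : ℂ) * w := by
      change (w : ℂ) - (r : ℂ) * w = _
      push_cast; ring
    rw [this, norm_mul, Complex.norm_real, Real.norm_of_nonneg (by linarith)]
    exact lt_of_le_of_lt (mul_le_of_le_one_right (by linarith) hw) hrδ
  have h2 := hn ((r : ℂ) * w) (mem_ball_zero_iff.2 (hrw.trans_lt (by
    change r < (2 * r + 1) / 3
    linarith)))
  rw [zero_add, hFf w' (mem_ball_zero_iff.2 (hrw.trans_lt hr1))] at h2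
  have h3 : ((∑ k ∈ Finset.range n, ((r : ℂ) ^ k * p.coeff k) • mono k : diskAlgebra) :
      C(closedBall (0 : ℂ) 1, ℂ)) w = p.partialSum n ((r : ℂ) * w) := by
    rw [AddSubmonoidClass.coe_finsetSum, ContinuousMap.sum_apply]
    refine Finset.sum_congr rfl fun k _ => ?_
    rw [FormalMultilinearSeries.apply_eq_pow_smul_coeff]
    change ((r : ℂ) ^ k * p.coeff k) * (w : ℂ) ^ k = _
    rw [smul_eq_mul, mul_pow]; ring
  rw [h3]
  refine (dist_triangle _ (f w') _).trans ?_
  linarith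

/-- A vector orthogonal to all Szegő kernel vectors vanishes. -/
theorem eq_zero_of_inner_szego {H : Type*} [NormedAddCommGroup H] [InnerProductSpace ℂ H]
    (J : diskAlgebra →L[ℂ] H) (hJ : DenseRange J) (h : H)
    (hz : ∀ z : 𝔻, ⟪J (szego z), h⟫_ℂ = 0) : h = 0 := by
  let φ : diskAlgebra →L[ℂ] ℂ := (innerSL ℂ h).comp J
  have hφ : ∀ a, φ a = ⟪h, J a⟫_ℂ := fun a => rfl
  have hsum : ∀ w : ℂ, ‖w‖ < 1 → HasSum (fun n => w ^ n • φ (mono n)) 0 := by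
    intro w hw
    have h1 := φ.hasSum (hasSum_szego (Complex.UnitDisc.mk (conj w) (by simpa using hw)))
    have h0 : φ (szego (Complex.UnitDisc.mk (conj w) (by simpa using hw))) = 0 := by
      rw [hφ, ← inner_conj_symm, hz, map_zero]
    rw [h0] at h1
    simpa using h1
  let p : FormalMultilinearSeries ℂ ℂ ℂ := .ofScalars ℂ (fun n => φ (mono n))
  have hp : HasFPowerSeriesAt (0 : ℂ → ℂ) p 0 := by
    rw [hasFPowerSeriesAt_iff]
    filter_upwards [ball_mem_nhds (0 : ℂ) one_pos] with w hw
    simpa [p, FormalMultilinearSeries.coeff_ofScalars] using hsum w (mem_ball_zero_iff.1 hw)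
  have hmono : ∀ n, φ (mono n) = 0 := by
    intro n
    have h2 : p.coeff n = 0 := by
      rw [hp.eq_zero]; rfl
    simpa [p, FormalMultilinearSeries.coeff_ofScalars] using h2
  have hker : ∀ a, φ a = 0 := by
    intro a
    have ha : a ∈ (Submodule.span ℂ (Set.range mono)).topologicalClosure := by
      rw [span_mono_dense]; trivial
    have hle : (Submodule.span ℂ (Set.range mono)).topologicalClosure ≤
        LinearMap.ker φ.toLinearMap :=
      Submodule.topologicalClosure_minimal _
        (Submodule.span_le.2 (by rintro _ ⟨n, rfl⟩; exact hmono n)) φ.isClosed_ker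
    exact hle ha
  exact hJ.eq_zero_of_inner_left ℂ (fun a => hker a)

/-! ### Hardy spaces and spaces of Cauchy transforms of measures -/

section Measures

variable (μ lam : Measure circ) [IsFiniteMeasure μ] [IsFiniteMeasure lam]

/-- The map `A(𝔻) → L²(μ)`. -/
def toL2 : diskAlgebra →L[ℂ] Lp ℂ 2 μ := (ContinuousMap.toLp 2 μ ℂ).comp boundary

/-- `H²(μ)`, the closure of the analytic polynomials in `L²(μ)`. -/
def hardy : Submodule ℂ (Lp ℂ 2 μ) :=
  (Submodule.span ℂ (Set.range fun n => toL2 μ (mono n))).topologicalClosure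

instance : CompleteSpace (hardy μ) :=
  (Submodule.isClosed_topologicalClosure _).completeSpace_coe

theorem toL2_mem_hardy (a : diskAlgebra) : toL2 μ a ∈ hardy μ := by
  have ha : a ∈ (Submodule.span ℂ (Set.range mono)).topologicalClosure := by
    rw [span_mono_dense]; trivial
  have h1 := Submodule.topologicalClosure_map (toL2 μ) (Submodule.span ℂ (Set.range mono))
    (Submodule.mem_map_of_mem ha)
  rw [Submodule.map_span, ← Set.range_comp] at h1
  exact h1

/-- The canonical map of the disk algebra into `H²(μ)`. -/
def toHardy : diskAlgebra →L[ℂ] hardy μ := (toL2 μ).codRestrict (hardy μ) (toL2_mem_hardy μ)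

theorem denseRange_toHardy : DenseRange (toHardy μ) := by
  intro x
  have hx : (x : Lp ℂ 2 μ) ∈ closure (Set.range (toL2 μ)) := by
    refine closure_mono ?_ x.2
    have : Submodule.span ℂ (Set.range fun n => toL2 μ (mono n)) ≤
        LinearMap.range (toL2 μ).toLinearMap :=
      Submodule.span_le.2 (by rintro _ ⟨n, rfl⟩; exact ⟨mono n, rfl⟩)
    exact this
  rw [IsInducing.subtypeVal.closure_eq_preimage_closure_image]
  rw [← Set.range_comp]
  exact hx

/-- The space `ℋ⁺(μ)` of `μ`-Cauchy transforms: the Hilbert space `H²(μ)`, its elements `h` being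
regarded as the functions `𝒞_μ h` in the disk. -/
def HPlus : Type := hardy μ

instance : NormedAddCommGroup (HPlus μ) := inferInstanceAs (NormedAddCommGroup (hardy μ))
instance : InnerProductSpace ℂ (HPlus μ) := inferInstanceAs (InnerProductSpace ℂ (hardy μ))
instance : CompleteSpace (HPlus μ) := inferInstanceAs (CompleteSpace (hardy μ))

/-- The Cauchy transform `𝒞_μ` as a unitary map of `H²(μ)` onto `ℋ⁺(μ)`. -/
def cauchy : hardy μ ≃ₗᵢ[ℂ] HPlus μ := LinearIsometryEquiv.refl ℂ (hardy μ)

/-- The reproducing kernel Hilbert space structure of `ℋ⁺(μ)`: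
the function in the disk is `z ↦ ⟪k_z, h⟫`. -/
instance : RKHS ℂ (HPlus μ) 𝔻 ℂ where
  coeCLM := ContinuousLinearMap.pi fun z =>
    (innerSL ℂ (toHardy μ (szego z))).comp
      ((cauchy μ).symm.toContinuousLinearEquiv : HPlus μ →L[ℂ] hardy μ)
  coeCLM_injective := by
    rw [injective_iff_map_eq_zero]
    intro f hf
    exact eq_zero_of_inner_szego (toHardy μ) (denseRange_toHardy μ) ((cauchy μ).symm f)
      fun z => congrFun hf z

/-- The functions in `ℋ⁺(μ)` are the Cauchy integrals of the elements of `H²(μ)`. -/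
theorem cauchy_apply (h : hardy μ) (z : 𝔻) :
    cauchy μ h z = ∫ ζ : circ, (h : Lp ℂ 2 μ) ζ / (1 - (z : ℂ) * conj (ζ : ℂ)) ∂μ := by
  change ⟪(toL2 μ (szego z) : Lp ℂ 2 μ), (h : Lp ℂ 2 μ)⟫_ℂ = _
  rw [L2.inner_def]
  refine integral_congr_ae ?_
  filter_upwards [ContinuousMap.coeFn_toLp (p := 2) (𝕜 := ℂ) μ (boundary (szego z))] with ζ hζ
  have h1 : (toL2 μ (szego z) : Lp ℂ 2 μ) ζ = (1 - conj (z : ℂ) * (ζ : ℂ))⁻¹ := hζ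
  rw [h1, RCLike.inner_apply]
  simp [div_eq_mul_inv]

/-- `int(μ, λ) = ℋ⁺(μ) ∩ ℋ⁺(λ)`, as a subspace of `ℋ⁺(μ)`. -/
def inter : Submodule ℂ (HPlus μ) where
  carrier := {f | ∃ g : HPlus lam, (g : 𝔻 → ℂ) = f}
  add_mem' := by
    rintro f f' ⟨g, hg⟩ ⟨g', hg'⟩
    exact ⟨g + g', by rw [RKHS.coe_add, RKHS.coe_add, hg, hg']⟩
  zero_mem' := ⟨0, by rw [RKHS.coe_zero, RKHS.coe_zero]⟩
  smul_mem' := by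
    rintro c f ⟨g, hg⟩
    exact ⟨c • g, by rw [RKHS.coe_smul, RKHS.coe_smul, hg]⟩

/-- The closure of `int(μ, λ)` in the norm of `ℋ⁺(μ)`. -/
abbrev interClosure : Submodule ℂ (HPlus μ) := (inter μ lam).topologicalClosure

instance : CompleteSpace (interClosure μ lam) :=
  (Submodule.isClosed_topologicalClosure _).completeSpace_coe

/-- The embedding `e : int(μ, λ) → ℋ⁺(λ)`, which sends a function to itself, as an operator with
domain `int(μ, λ)`, densely defined in the Hilbert space closure of `int(μ, λ)` in `ℋ⁺(μ)`. -/
def embedding : interClosure μ lam →ₗ.[ℂ] HPlus lam where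
  domain := (inter μ lam).comap (interClosure μ lam).subtype
  toFun :=
    { toFun := fun f => Classical.choose f.2
      map_add' := fun f g => DFunLike.coe_injective <| by
        refine (Classical.choose_spec (f + g).2).trans ?_
        refine (RKHS.coe_add _ _).trans ?_
        refine Eq.trans ?_ (RKHS.coe_add _ _).symm
        exact congrArg₂ _ (Classical.choose_spec f.2).symm (Classical.choose_spec g.2).symm
      map_smul' := fun c f => DFunLike.coe_injective <| by
        refine (Classical.choose_spec (c • f).2).trans ?_
        refine (RKHS.coe_smul _ _).trans ?_
        refine Eq.trans ?_ (RKHS.coe_smul _ _).symm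
        exact congrArg _ (Classical.choose_spec f.2).symm }

theorem embedding_apply (f : (embedding μ lam).domain) (z : 𝔻) :
    embedding μ lam f z = ((f : interClosure μ lam) : HPlus μ) z :=
  congrFun (Classical.choose_spec f.2) z

theorem dense_embedding_domain : Dense ((embedding μ lam).domain : Set (interClosure μ lam)) := by
  intro x
  rw [IsInducing.subtypeVal.closure_eq_preimage_closure_image]
  refine closure_mono ?_ x.2
  intro f hf
  exact ⟨⟨f, subset_closure hf⟩, hf, rfl⟩

/-- The operator `𝒞_λ* e e* 𝒞_λ` in `H²(λ)`, on its natural domain. -/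
def opD : hardy lam →ₗ.[ℂ] hardy lam :=
  opComp
    (((ContinuousLinearMap.adjoint
      ((cauchy lam).toContinuousLinearEquiv : hardy lam →L[ℂ] HPlus lam)) :
        HPlus lam →ₗ[ℂ] hardy lam).toPMap ⊤)
    (opComp (embedding μ lam)
      (opComp (embedding μ lam).adjoint
        ((((cauchy lam).toContinuousLinearEquiv : hardy lam →L[ℂ] HPlus lam) :
          hardy lam →ₗ[ℂ] HPlus lam).toPMap ⊤)))

theorem integrable_conj_mul (g h : diskAlgebra) :
    Integrable (fun ζ => conj (boundary g ζ) * boundary h ζ) μ :=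
  Continuous.integrable_of_hasCompactSupport (by fun_prop) (HasCompactSupport.of_compactSpace _)

/-- The form `q_μ(g, h) = ∫ ḡ h dμ` on the disk algebra. -/
def measureForm : PSForm diskAlgebra where
  toFun := LinearMap.mk₂'ₛₗ (starRingEnd ℂ) (RingHom.id ℂ)
    (fun g h => ∫ ζ, conj (boundary g ζ) * boundary h ζ ∂μ)
    (fun g g' h => by
      rw [← integral_add (integrable_conj_mul μ g h) (integrable_conj_mul μ g' h)]
      simp [add_mul])
    (fun c g h => by
      rw [smul_eq_mul, ← integral_const_mul]
      simp [mul_assoc])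
    (fun g h h' => by
      rw [← integral_add (integrable_conj_mul μ g h) (integrable_conj_mul μ g h')]
      simp [mul_add])
    (fun c g h => by
      rw [RingHom.id_apply, smul_eq_mul, ← integral_const_mul]
      simp [mul_left_comm])
  isPosSemidef := LinearMap.isPosSemidef_def.2
    ⟨⟨fun g h => by
      simp only [LinearMap.mk₂'ₛₗ_apply]
      rw [← integral_conj]
      simp [mul_comm]⟩,
    ⟨fun g => by
      simp only [LinearMap.mk₂'ₛₗ_apply]
      simp_rw [Complex.conj_mul']
      norm_cast
      exact integral_nonneg fun _ => by positivity⟩⟩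

theorem measureForm_apply (g h : diskAlgebra) :
    measureForm μ g h = ∫ ζ, conj (boundary g ζ) * boundary h ζ ∂μ := rfl

theorem measureForm_le (a : diskAlgebra) : (measureForm μ a a).re ≤ μ.real Set.univ * ‖a‖ ^ 2 := by
  rw [measureForm_apply]
  refine (Complex.re_le_norm _).trans ?_
  rw [mul_comm]
  refine norm_integral_le_of_norm_le_const (Eventually.of_forall fun ζ => ?_)
  rw [norm_mul, RCLike.norm_conj, sq]
  have h : ‖boundary a ζ‖ ≤ ‖a‖ := (a : C(closedBall (0 : ℂ) 1, ℂ)).norm_coe_le_norm _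
  gcongr

end Measures

/-! ### Cauchy transforms of forms on the disk algebra -/

section FormSpaces

/-- The disk algebra with the semi-inner product `q`. -/
def PreH2 (_q : PSForm diskAlgebra) : Type := diskAlgebra

variable (q : PSForm diskAlgebra)

instance : AddCommGroup (PreH2 q) := inferInstanceAs (AddCommGroup diskAlgebra)
instance : Module ℂ (PreH2 q) := inferInstanceAs (Module ℂ diskAlgebra)

instance : PreInnerProductSpace.Core ℂ (PreH2 q) where
  inner f g := q.toFun f g
  conj_inner_symm f g := q.isPosSemidef.isSymm.eq g f
  re_inner_nonneg f := (Complex.nonneg_iff.1 (q.isPosSemidef.isNonneg.nonneg f)).1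
  add_left f g h := LinearMap.map_add₂ q.toFun f g h
  smul_left f g c := LinearMap.map_smulₛₗ₂ q.toFun c f g

instance : SeminormedAddCommGroup (PreH2 q) :=
  InnerProductSpace.Core.toSeminormedAddCommGroup (𝕜 := ℂ)

instance : InnerProductSpace ℂ (PreH2 q) := .ofCore _

/-- `H²(q)`: the Hilbert space completion of the disk algebra, modulo vectors of length zero,
for the semi-inner product `q`. -/
abbrev H2 : Type := UniformSpace.Completion (PreH2 q)

/-- The canonical map of the disk algebra into `H²(q)`. -/
def toH2 : diskAlgebra →ₗ[ℂ] H2 q :=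
  (UniformSpace.Completion.toComplL : PreH2 q →L[ℂ] H2 q).toLinearMap

theorem inner_toH2 (f g : diskAlgebra) : ⟪toH2 q f, toH2 q g⟫_ℂ = q f g :=
  UniformSpace.Completion.inner_coe (𝕜 := ℂ) (E := PreH2 q) f g

variable (μ : Measure circ) [IsFiniteMeasure μ]

/-- The space `ℋ⁺(q)` of `q`-Cauchy transforms, for a positive form `q ≤ q_μ` on the disk algebra:
the Hilbert space `H²(q)`, its elements `h` being regarded as the functions
`z ↦ q(k_z, h)` in the disk. -/
def FormHPlus (_hq : ∀ a, q a a ≤ measureForm μ a a) : Type := H2 q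

variable (hq : ∀ a, q a a ≤ measureForm μ a a)

instance : NormedAddCommGroup (FormHPlus q μ hq) := inferInstanceAs (NormedAddCommGroup (H2 q))
instance : InnerProductSpace ℂ (FormHPlus q μ hq) := inferInstanceAs (InnerProductSpace ℂ (H2 q))
instance : CompleteSpace (FormHPlus q μ hq) := inferInstanceAs (CompleteSpace (H2 q))

/-- The Cauchy transform as a unitary map of `H²(q)` onto `ℋ⁺(q)`. -/
def formCauchy : H2 q ≃ₗᵢ[ℂ] FormHPlus q μ hq := LinearIsometryEquiv.refl ℂ (H2 q)

theorem formCauchy_injective (h : H2 q) (hz : ∀ z : 𝔻, ⟪toH2 q (szego z), h⟫_ℂ = 0)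
    (hq : ∀ a, q a a ≤ measureForm μ a a) : h = 0 := by
  let J : diskAlgebra →L[ℂ] H2 q :=
    (toH2 q).mkContinuous (√(μ.real Set.univ)) fun a => by
      refine abs_le_of_sq_le_sq' ?_ (by positivity) |>.2
      rw [mul_pow, Real.sq_sqrt (by positivity), ← inner_self_eq_norm_sq (𝕜 := ℂ), inner_toH2]
      exact (Complex.le_def.1 (hq a)).1.trans (measureForm_le μ a)
  exact eq_zero_of_inner_szego J
    (UniformSpace.Completion.denseRange_coe (α := PreH2 q)) h hz

instance : RKHS ℂ (FormHPlus q μ hq) 𝔻 ℂ where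
  coeCLM := ContinuousLinearMap.pi fun z =>
    (innerSL ℂ (toH2 q (szego z))).comp
      ((formCauchy q μ hq).symm.toContinuousLinearEquiv : FormHPlus q μ hq →L[ℂ] H2 q)
  coeCLM_injective := by
    rw [injective_iff_map_eq_zero]
    intro f hf
    exact formCauchy_injective q μ ((formCauchy q μ hq).symm f) (fun z => congrFun hf z) hq

theorem formCauchy_apply (h : H2 q) (z : 𝔻) :
    formCauchy q μ hq h z = ⟪toH2 q (szego z), h⟫_ℂ := rfl

end FormSpaces

end

end CauchyForms

open CauchyForms

/-! Two functions `f = 𝒞_μ h` and `g = 𝒞_λ k` agree on `𝔻` if and only if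
`⟪𝒞_μ a, f⟫_μ = ⟪𝒞_λ a, g⟫_λ` for all `a ∈ A(𝔻)`. So the graph of `𝒞_λ* e` is the adjoint of the
linear relation `{(a, 𝒞_μ a)}` in `H²(λ) × ℋ⁺(μ)`, and the graph of `T = (𝒞_λ* e)* = e* 𝒞_λ`
consists of the pairs in the closure of this relation whose second entry lies in the closure of
`int(μ, λ)`. In particular `e` is closed, and every `(a, P 𝒞_μ a)`, with `P` the projection onto the
closure of `int(μ, λ)`, lies in the graph of `T`. Therefore
`q_ac(a, b) = ⟪P 𝒞_μ a, P 𝒞_μ b⟫` has the closure `⟪T x, T y⟫`, which is the form of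
`T* T = 𝒞_λ* e e* 𝒞_λ = D`, and the form of the `(1 - P) 𝒞_μ a` is singular. The square root of `D`
is built from the contraction `R = (1 + D)⁻¹`, the graph projection of `T` times its adjoint:
`D = (1 - R) R⁻¹` and `√D = √(1 - R) (√R)⁻¹`. -/

namespace CauchyForms

section Forms

variable {V H E : Type*} [AddCommGroup V] [Module ℂ V]
variable [NormedAddCommGroup H] [InnerProductSpace ℂ H]
variable [NormedAddCommGroup E] [InnerProductSpace ℂ E]

/-- The semi-inner product on `V` given by a positive form `q`. -/
@[reducible]
def PSForm.core (q : PSForm V) : PreInnerProductSpace.Core ℂ V where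
  inner x y := q x y
  conj_inner_symm x y := q.isPosSemidef.isSymm.eq y x
  re_inner_nonneg x := (Complex.nonneg_iff.1 (q.isPosSemidef.isNonneg.nonneg x)).1
  add_left x y z := LinearMap.map_add₂ q.toFun x y z
  smul_left x y c := LinearMap.map_smulₛₗ₂ q.toFun c x y

/-- The seminorm `x ↦ √q(x, x)` of a positive form `q`. -/
noncomputable def PSForm.seminorm (q : PSForm V) : Seminorm ℂ V :=
  letI := q.core
  letI : SeminormedAddCommGroup V := InnerProductSpace.Core.toSeminormedAddCommGroup (𝕜 := ℂ)
  letI : NormedSpace ℂ V := InnerProductSpace.Core.toNormedSpace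
  normSeminorm ℂ V

theorem PSForm.apply_self (q : PSForm V) (x : V) : q x x = ((q.seminorm x ^ 2 : ℝ) : ℂ) := by
  let := q.core
  let : SeminormedAddCommGroup V := InnerProductSpace.Core.toSeminormedAddCommGroup (𝕜 := ℂ)
  let : InnerProductSpace ℂ V := .ofCore _
  push_cast
  exact inner_self_eq_norm_sq_to_K (𝕜 := ℂ) x

theorem PSForm.re_apply_self (q : PSForm V) (x : V) : (q x x).re = q.seminorm x ^ 2 := by
  rw [q.apply_self, Complex.ofReal_re]

theorem PSForm.apply_self_le_apply_self {W : Type*} [AddCommGroup W] [Module ℂ W]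
    {p : PSForm V} {q : PSForm W} {x : V} {y : W} :
    p x x ≤ q y y ↔ p.seminorm x ≤ q.seminorm y := by
  rw [p.apply_self, q.apply_self, Complex.real_le_real,
    pow_le_pow_iff_left₀ (apply_nonneg _ _) (apply_nonneg _ _) two_ne_zero]

theorem PSForm.apply_eq_sum_seminorm_sq (q : PSForm V) (x y : V) :
    q x y = ((q.seminorm (x + y) : ℂ) ^ 2 - (q.seminorm (x - y) : ℂ) ^ 2 +
      ((q.seminorm (x - Complex.I • y) : ℂ) ^ 2 -
        (q.seminorm (x + Complex.I • y) : ℂ) ^ 2) * Complex.I) / 4 := by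
  let := q.core
  let : SeminormedAddCommGroup V := InnerProductSpace.Core.toSeminormedAddCommGroup (𝕜 := ℂ)
  let : InnerProductSpace ℂ V := .ofCore _
  exact inner_eq_sum_norm_sq_div_four (𝕜 := ℂ) x y

theorem PSForm.apply_eq_apply_of_seminorm {W : Type*} [AddCommGroup W] [Module ℂ W]
    {p : PSForm V} {q : PSForm W} (f : W →ₗ[ℂ] V) (h : ∀ x, p.seminorm (f x) = q.seminorm x)
    (x y : W) : p (f x) (f y) = q x y := by
  rw [p.apply_eq_sum_seminorm_sq, q.apply_eq_sum_seminorm_sq]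
  simp only [← map_add, ← map_sub, ← map_smul, h]

theorem PSForm.ext {p q : PSForm V} (h : ∀ x y, p x y = q x y) : p = q := by
  cases p; cases q
  congr 1
  exact LinearMap.ext₂ h

/-- The form `⟪j x, j y⟫` induced by a linear map `j` into an inner product space. -/
noncomputable def PSForm.ofMap (j : V →ₗ[ℂ] E) : PSForm V where
  toFun := ((innerₛₗ ℂ).comp j).compl₂ j
  isPosSemidef := LinearMap.isPosSemidef_def.2
    ⟨⟨fun x y => inner_conj_symm (j y) (j x)⟩,
      ⟨fun x => Complex.nonneg_iff.2
        ⟨inner_self_nonneg (𝕜 := ℂ), (inner_self_im (𝕜 := ℂ) (j x)).symm⟩⟩⟩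

theorem PSForm.ofMap_apply (j : V →ₗ[ℂ] E) (x y : V) : PSForm.ofMap j x y = ⟪j x, j y⟫_ℂ := rfl

theorem PSForm.seminorm_ofMap (j : V →ₗ[ℂ] E) (x : V) : (PSForm.ofMap j).seminorm x = ‖j x‖ := by
  rw [← sq_eq_sq₀ (apply_nonneg _ _) (norm_nonneg _), ← PSForm.re_apply_self, PSForm.ofMap_apply]
  exact inner_self_eq_norm_sq (𝕜 := ℂ) (j x)

theorem DenseForm.le_iff {p : DenseForm H} {ι : V →ₗ[ℂ] H} {q : PSForm V} :
    p.LE ι q ↔ ∃ h : ∀ v, ι v ∈ p.dom, ∀ v, p.form.seminorm ⟨ι v, h v⟩ ≤ q.seminorm v := by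
  simp only [DenseForm.LE, PSForm.apply_self_le_apply_self]

theorem DenseForm.extends_iff {t : DenseForm H} {ι : V →ₗ[ℂ] H} {q : PSForm V} :
    t.Extends ι q ↔
      ∃ h : ∀ v, ι v ∈ t.dom, ∀ v, t.form.seminorm ⟨ι v, h v⟩ = q.seminorm v := by
  refine exists_congr fun h => ⟨fun heq v => ?_, fun heq =>
    PSForm.apply_eq_apply_of_seminorm (ι.codRestrict t.dom h) heq⟩
  rw [← sq_eq_sq₀ (apply_nonneg _ _) (apply_nonneg _ _), ← PSForm.re_apply_self,
    ← PSForm.re_apply_self, heq]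

theorem DenseForm.IsClosed.isCloseable {t : DenseForm H} (ht : t.IsClosed) :
    IsCloseable t.dom.subtype t.form :=
  ⟨t, ht, fun x => x.2, fun _ _ => rfl⟩

theorem IsSimonLebesgue.le_of_le {ι : V →ₗ[ℂ] H} {q qac qs p : PSForm V}
    (h : IsSimonLebesgue ι q qac qs) (hp : IsCloseable ι p) (hle : ∀ v, p v v ≤ q v v) (v : V) :
    p v v ≤ qac v v := by
  obtain ⟨t, ht, hι, heq⟩ := hp
  obtain ⟨_, hmax⟩ := h.maximal t ht.isCloseable ⟨hι, fun v => (heq v v).trans_le (hle v)⟩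
  exact (heq v v).symm.trans_le (hmax v)

theorem IsSimonLebesgue.unique {ι : V →ₗ[ℂ] H} {q qac qs pac ps : PSForm V}
    (h : IsSimonLebesgue ι q qac qs) (h' : IsSimonLebesgue ι q pac ps) : qac = pac ∧ qs = ps := by
  have hac : qac = pac := PSForm.ext <| PSForm.apply_eq_apply_of_seminorm LinearMap.id fun v =>
    le_antisymm (PSForm.apply_self_le_apply_self.1 (h'.le_of_le h.closeable h.ac_le v))
      (PSForm.apply_self_le_apply_self.1 (h.le_of_le h'.closeable h'.ac_le v))
  subst hac
  exact ⟨rfl, PSForm.ext fun v w => add_left_cancel ((h.add_eq v w).symm.trans (h'.add_eq v w))⟩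

theorem tendsto_sq_add_sq_zero_iff {α : Type*} {l : Filter α} {f g : α → ℝ} :
    Tendsto (fun i => f i ^ 2 + g i ^ 2) l (𝓝 0) ↔ Tendsto f l (𝓝 0) ∧ Tendsto g l (𝓝 0) := by
  constructor
  · intro h
    have hf := squeeze_zero (fun i => sq_nonneg (f i))
      (fun i => le_add_of_nonneg_right (sq_nonneg (g i))) h
    have hg := squeeze_zero (fun i => sq_nonneg (g i))
      (fun i => le_add_of_nonneg_left (sq_nonneg (f i))) h
    rw [tendsto_zero_iff_abs_tendsto_zero f, tendsto_zero_iff_abs_tendsto_zero g]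
    simpa [Real.sqrt_sq_eq_abs, Function.comp_def] using And.intro hf.sqrt hg.sqrt
  · rintro ⟨hf, hg⟩
    simpa using (hf.pow 2).add (hg.pow 2)

theorem tendsto_prod_atTop_zero_iff {f : ℕ × ℕ → ℝ} (hf : ∀ p, 0 ≤ f p) :
    Tendsto f atTop (𝓝 0) ↔
      ∀ ε, 0 < ε → ∃ N, ∀ m, N ≤ m → ∀ n, N ≤ n → f (m, n) < ε := by
  rw [← prod_atTop_atTop_eq, atTop_basis.prod_self.tendsto_iff nhds_basis_ball]
  simp only [Set.mem_prod, Set.mem_Ici, Prod.forall, and_imp, true_and, mem_ball_zero_iff,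
    Real.norm_of_nonneg (hf _)]
  exact ⟨fun h ε hε => (h ε hε).imp fun N hN m hm n hn => hN m n hm hn,
    fun h ε hε => (h ε hε).imp fun N hN m n hm hn => hN m hm n hn⟩

theorem DenseForm.isClosed_iff [CompleteSpace H] {t : DenseForm H} :
    t.IsClosed ↔ ∀ (u : ℕ → t.dom) (x : H), Tendsto (fun n => (u n : H)) atTop (𝓝 x) →
      Tendsto (fun p : ℕ × ℕ => t.form.seminorm (u p.1 - u p.2)) atTop (𝓝 0) →
      ∃ hx : x ∈ t.dom, Tendsto (fun n => t.form.seminorm (u n - ⟨x, hx⟩)) atTop (𝓝 0) := by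
  have hcauchy (u : ℕ → t.dom) :
      (∀ ε : ℝ, 0 < ε → ∃ N, ∀ m, N ≤ m → ∀ n, N ≤ n →
        ‖u m - u n‖ ^ 2 + (t.form (u m - u n) (u m - u n)).re < ε) ↔
      CauchySeq (fun n => (u n : H)) ∧
        Tendsto (fun p : ℕ × ℕ => t.form.seminorm (u p.1 - u p.2)) atTop (𝓝 0) := by
    simp only [PSForm.re_apply_self, cauchySeq_iff_tendsto_dist_atTop_0, dist_eq_norm]
    exact (tendsto_prod_atTop_zero_iff (f := fun p => ‖u p.1 - u p.2‖ ^ 2 +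
      t.form.seminorm (u p.1 - u p.2) ^ 2) fun p => by positivity).symm.trans
      tendsto_sq_add_sq_zero_iff
  have hlim (u : ℕ → t.dom) (x : t.dom) :
      Tendsto (fun n => ‖u n - x‖ ^ 2 + (t.form (u n - x) (u n - x)).re) atTop (𝓝 0) ↔
        Tendsto (fun n => (u n : H)) atTop (𝓝 x) ∧
          Tendsto (fun n => t.form.seminorm (u n - x)) atTop (𝓝 0) := by
    simp only [PSForm.re_apply_self, tendsto_iff_norm_sub_tendsto_zero (b := (x : H))]
    exact tendsto_sq_add_sq_zero_iff
  simp only [DenseForm.IsClosed, hcauchy, hlim]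
  constructor
  · intro h u x hu hsemi
    obtain ⟨y, hy, hy'⟩ := h u ⟨hu.cauchySeq, hsemi⟩
    obtain rfl := tendsto_nhds_unique hu hy
    exact ⟨y.2, hy'⟩
  · rintro h u ⟨hu, hsemi⟩
    obtain ⟨x, hx⟩ := cauchySeq_tendsto_of_complete hu
    obtain ⟨hxt, hx'⟩ := h u x hx hsemi
    exact ⟨⟨x, hxt⟩, hx, hx'⟩

theorem DenseForm.IsClosed.exists_tendsto [CompleteSpace H] {s : DenseForm H} (hs : s.IsClosed)
    {ι : V →ₗ[ℂ] H} {j : V →ₗ[ℂ] E} (hι : ∀ v, ι v ∈ s.dom)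
    (hle : ∀ v, s.form.seminorm ⟨ι v, hι v⟩ ≤ ‖j v‖) {x : H} {y : E}
    (hxy : (x, y) ∈ (LinearMap.range (ι.prod j)).topologicalClosure) :
    ∃ hx : x ∈ s.dom, ∃ a : ℕ → V, Tendsto (fun n => ι (a n)) atTop (𝓝 x) ∧
      Tendsto (fun n => j (a n)) atTop (𝓝 y) ∧
      Tendsto (fun n => s.form.seminorm ⟨ι (a n), hι (a n)⟩) atTop
        (𝓝 (s.form.seminorm ⟨x, hx⟩)) := by
  obtain ⟨b, hb, hlim⟩ := mem_closure_iff_seq_limit.1 hxy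
  choose a ha using hb
  obtain rfl : b = fun n => (ι (a n), j (a n)) := funext fun n => (ha n).symm
  obtain ⟨hιa, hja⟩ := (Prod.tendsto_iff _ _).1 hlim
  obtain ⟨hx, hsemi⟩ := DenseForm.isClosed_iff.1 hs (fun n => ⟨ι (a n), hι (a n)⟩) x hιa <| by
    refine squeeze_zero (fun _ => apply_nonneg _ _) (fun p => ?_)
      (cauchySeq_iff_tendsto_dist_atTop_0.1 hja.cauchySeq)
    calc s.form.seminorm (⟨ι (a p.1), hι _⟩ - ⟨ι (a p.2), hι _⟩)
        = s.form.seminorm ⟨ι (a p.1 - a p.2), hι _⟩ :=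
          congrArg _ (Subtype.ext (map_sub ι _ _).symm)
      _ ≤ ‖j (a p.1 - a p.2)‖ := hle _
      _ = dist (j (a p.1)) (j (a p.2)) := by rw [map_sub, dist_eq_norm]
  refine ⟨hx, a, hιa, hja, ?_⟩
  rw [tendsto_iff_dist_tendsto_zero]
  exact squeeze_zero (fun _ => dist_nonneg) (fun n => abs_sub_map_le_sub _ _ _) hsemi

theorem IsCloseable.seminorm_le [CompleteSpace H] {p : DenseForm H}
    (hp : IsCloseable p.dom.subtype p.form) {ι : V →ₗ[ℂ] H} {j : V →ₗ[ℂ] E}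
    (hle : p.LE ι (PSForm.ofMap j)) {x : H} {y : E} (hx : x ∈ p.dom)
    (hxy : (x, y) ∈ (LinearMap.range (ι.prod j)).topologicalClosure) :
    p.form.seminorm ⟨x, hx⟩ ≤ ‖y‖ := by
  obtain ⟨s, hs, hext⟩ := hp
  obtain ⟨hι, hle⟩ := DenseForm.le_iff.1 hle
  obtain ⟨hsub, heq⟩ := DenseForm.extends_iff.1 hext
  have hle' (v : V) : s.form.seminorm ⟨ι v, hsub ⟨ι v, hι v⟩⟩ ≤ ‖j v‖ := by
    simpa [PSForm.seminorm_ofMap] using (heq ⟨ι v, hι v⟩).trans_le (hle v)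
  obtain ⟨_, a, _, hja, hsa⟩ := hs.exists_tendsto (fun v => hsub ⟨ι v, hι v⟩) hle' hxy
  exact (heq ⟨x, hx⟩).symm.trans_le (le_of_tendsto_of_tendsto' hsa hja.norm fun n => hle' (a n))

/-- The form `⟪T x, T y⟫` of a densely defined operator `T`. -/
noncomputable def DenseForm.ofOp (T : H →ₗ.[ℂ] E) (hT : Dense (T.domain : Set H)) :
    DenseForm H where
  dom := T.domain
  dense_dom := hT
  form := PSForm.ofMap T.toFun

theorem DenseForm.seminorm_ofOp_of_mem_graph {T : H →ₗ.[ℂ] E} (hT : Dense (T.domain : Set H))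
    {x : H} {y : E} (h : (x, y) ∈ T.graph) (hx : x ∈ (DenseForm.ofOp T hT).dom) :
    (DenseForm.ofOp T hT).form.seminorm ⟨x, hx⟩ = ‖y‖ := by
  obtain ⟨x, rfl, rfl⟩ := T.mem_graph_iff.1 h
  exact PSForm.seminorm_ofMap T.toFun x

theorem DenseForm.ofOp_isClosed [CompleteSpace H] [CompleteSpace E] {T : H →ₗ.[ℂ] E}
    (hT : Dense (T.domain : Set H)) (hcl : T.IsClosed) : (DenseForm.ofOp T hT).IsClosed := by
  refine DenseForm.isClosed_iff.2 fun u x hu hsemi => ?_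
  have hsemi' (x y : T.domain) : (DenseForm.ofOp T hT).form.seminorm (x - y) = ‖T x - T y‖ := by
    rw [← LinearPMap.map_sub]
    exact DenseForm.seminorm_ofOp_of_mem_graph hT (T.mem_graph (x - y)) _
  have hTu : CauchySeq fun n => T (u n) := by
    refine cauchySeq_iff_tendsto_dist_atTop_0.2 (hsemi.congr fun p => ?_)
    exact (hsemi' _ _).trans (dist_eq_norm _ _).symm
  obtain ⟨y, hy⟩ := cauchySeq_tendsto_of_complete hTu
  have hxy : (x, y) ∈ T.graph :=
    hcl.mem_of_tendsto (hu.prodMk_nhds hy) (Eventually.of_forall fun n => T.mem_graph (u n))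
  obtain ⟨x, rfl, rfl⟩ := (T.mem_graph_iff).1 hxy
  exact ⟨x.2, (tendsto_iff_norm_sub_tendsto_zero.1 hy).congr fun n => (hsemi' _ _).symm⟩

theorem DenseForm.ofOp_isClosureOf [CompleteSpace H] [CompleteSpace E] {T : H →ₗ.[ℂ] E}
    (hT : Dense (T.domain : Set H)) {ι : V →ₗ[ℂ] H} {j : V →ₗ[ℂ] E}
    (hgraph : T.graph = (LinearMap.range (ι.prod j)).topologicalClosure) :
    (DenseForm.ofOp T hT).IsClosureOf ι (PSForm.ofMap j) := by
  have hcl : T.IsClosed := by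
    rw [LinearPMap.IsClosed, hgraph]
    exact Submodule.isClosed_topologicalClosure _
  have hmem (v : V) : (ι v, j v) ∈ T.graph := by
    rw [hgraph]
    exact Submodule.le_topologicalClosure _ ⟨v, rfl⟩
  refine ⟨DenseForm.ofOp_isClosed hT hcl, DenseForm.extends_iff.2
    ⟨fun v => T.mem_domain_of_mem_graph (hmem v),
      fun v => (DenseForm.seminorm_ofOp_of_mem_graph hT (hmem v) _).trans
        (PSForm.seminorm_ofMap j v).symm⟩, fun s hs hext => ?_⟩
  obtain ⟨hι, heq⟩ := DenseForm.extends_iff.1 hext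
  have hdom (x : T.domain) : ∃ hx : (x : H) ∈ s.dom, s.form.seminorm ⟨x, hx⟩ = ‖T x‖ := by
    obtain ⟨hx, a, _, hja, hsa⟩ := hs.exists_tendsto hι
      (fun v => ((heq v).trans (PSForm.seminorm_ofMap j v)).le) (hgraph ▸ T.mem_graph x)
    refine ⟨hx, tendsto_nhds_unique hsa ?_⟩
    simpa only [heq, PSForm.seminorm_ofMap] using hja.norm
  exact DenseForm.extends_iff.2 ⟨fun x => (hdom x).1, fun x => (hdom x).2.trans
    (DenseForm.seminorm_ofOp_of_mem_graph hT (T.mem_graph x) x.2).symm⟩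

end Forms

section Relations

variable {E F : Type*} [NormedAddCommGroup E] [InnerProductSpace ℂ E]
variable [NormedAddCommGroup F] [InnerProductSpace ℂ F]

/-- A linear relation in `E × F`, regarded as a subspace of the Hilbert sum of `E` and `F`. -/
def l2Relation (g : Submodule ℂ (E × F)) : Submodule ℂ (WithLp 2 (E × F)) :=
  g.comap (WithLp.linearEquiv 2 ℂ (E × F)).toLinearMap

theorem mem_l2Relation {g : Submodule ℂ (E × F)} {x : E} {y : F} :
    WithLp.toLp 2 (x, y) ∈ l2Relation g ↔ (x, y) ∈ g := Iff.rfl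

theorem topologicalClosure_l2Relation (g : Submodule ℂ (E × F)) :
    (l2Relation g).topologicalClosure = l2Relation g.topologicalClosure :=
  SetLike.coe_injective
    ((WithLp.prodContinuousLinearEquiv 2 ℂ E F).toHomeomorph.preimage_closure
      (g : Set (E × F))).symm

theorem mem_adjoint_iff_mem_orthogonal {g : Submodule ℂ (E × F)} {x : F} {y : E} :
    (x, y) ∈ g.adjoint ↔ WithLp.toLp 2 (y, -x) ∈ (l2Relation g)ᗮ := by
  rw [Submodule.mem_adjoint_iff, Submodule.mem_orthogonal]
  refine ⟨fun h w hw => ?_, fun h a b hab => ?_⟩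
  · simpa [sub_eq_add_neg, add_comm] using congrArg Neg.neg (h _ _ hw)
  · simpa [sub_eq_add_neg, add_comm] using congrArg Neg.neg (h (WithLp.toLp 2 (a, b)) hab)

theorem adjoint_adjoint_relation [CompleteSpace E] [CompleteSpace F] (g : Submodule ℂ (E × F)) :
    g.adjoint.adjoint = g.topologicalClosure := by
  ext ⟨x, y⟩
  rw [← mem_l2Relation (g := g.topologicalClosure), ← topologicalClosure_l2Relation,
    ← Submodule.orthogonal_orthogonal_eq_closure, Submodule.mem_orthogonal,
    Submodule.mem_adjoint_iff]
  refine ⟨?_, fun h a b hab => ?_⟩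
  · rintro h ⟨a, b⟩ hab
    simpa using h (-b) a (mem_adjoint_iff_mem_orthogonal.2 (by rwa [neg_neg]))
  · simpa [sub_eq_add_neg] using h _ (mem_adjoint_iff_mem_orthogonal.1 hab)

theorem mem_adjoint_graph_iff [CompleteSpace E] {T : E →ₗ.[ℂ] F} (hT : Dense (T.domain : Set E))
    {x : F} {y : E} :
    (x, y) ∈ T.adjoint.graph ↔ ∀ a b, (a, b) ∈ T.graph → ⟪b, x⟫_ℂ = ⟪a, y⟫_ℂ := by
  rw [LinearPMap.adjoint_graph_eq_graph_adjoint hT, Submodule.mem_adjoint_iff]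
  simp only [sub_eq_zero]

theorem mem_opComp_graph {E F G : Type*} [AddCommGroup E] [Module ℂ E] [AddCommGroup F]
    [Module ℂ F] [AddCommGroup G] [Module ℂ G] {B : F →ₗ.[ℂ] G} {A : E →ₗ.[ℂ] F} {x : E} {z : G} :
    (x, z) ∈ (opComp B A).graph ↔ ∃ y, (x, y) ∈ A.graph ∧ (y, z) ∈ B.graph := by
  constructor
  · intro h
    obtain ⟨⟨x, hx⟩, rfl, rfl⟩ := (opComp B A).mem_graph_iff.1 h
    obtain ⟨hA, hB⟩ := (mem_opComp_domain B A x).1 hx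
    exact ⟨A ⟨x, hA⟩, A.mem_graph ⟨x, hA⟩, B.mem_graph ⟨_, hB⟩⟩
  · rintro ⟨y, hxy, hyz⟩
    obtain ⟨⟨x, hx⟩, rfl, rfl⟩ := A.mem_graph_iff.1 hxy
    obtain ⟨⟨y, hy⟩, hxy', rfl⟩ := B.mem_graph_iff.1 hyz
    obtain rfl : y = A ⟨x, hx⟩ := hxy'
    exact (opComp B A).mem_graph ⟨x, (mem_opComp_domain B A x).2 ⟨hx, hy⟩⟩

theorem mem_toPMap_top_graph {E F : Type*} [AddCommGroup E] [Module ℂ E] [AddCommGroup F]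
    [Module ℂ F] {A : E →ₗ[ℂ] F} {x : E} {y : F} : (x, y) ∈ (A.toPMap ⊤).graph ↔ A x = y := by
  rw [LinearPMap.mem_graph_iff]
  constructor
  · rintro ⟨x, rfl, rfl⟩
    rfl
  · rintro rfl
    exact ⟨⟨x, trivial⟩, rfl, rfl⟩

theorem opComp_assoc {E F G K : Type*} [AddCommGroup E] [Module ℂ E] [AddCommGroup F]
    [Module ℂ F] [AddCommGroup G] [Module ℂ G] [AddCommGroup K] [Module ℂ K]
    (C : G →ₗ.[ℂ] K) (B : F →ₗ.[ℂ] G) (A : E →ₗ.[ℂ] F) :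
    opComp (opComp C B) A = opComp C (opComp B A) := by
  refine LinearPMap.eq_of_eq_graph ?_
  ext ⟨x, z⟩
  simp only [mem_opComp_graph]
  grind

theorem adjoint_opComp_toPMap {G : Type*} [NormedAddCommGroup G] [InnerProductSpace ℂ G]
    [CompleteSpace E] [CompleteSpace F] [CompleteSpace G] {T : E →ₗ.[ℂ] F}
    (hT : Dense (T.domain : Set E)) (B : F →L[ℂ] G) :
    (opComp (B.toLinearMap.toPMap ⊤) T).adjoint =
      opComp T.adjoint (B.adjoint.toLinearMap.toPMap ⊤) := by
  have hdom : (opComp (B.toLinearMap.toPMap ⊤) T).domain = T.domain := by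
    ext x
    simp [mem_opComp_domain]
  refine LinearPMap.eq_of_eq_graph ?_
  ext ⟨x, y⟩
  rw [mem_adjoint_graph_iff (hdom ▸ hT)]
  simp only [mem_opComp_graph, mem_toPMap_top_graph, ContinuousLinearMap.coe_coe,
    exists_eq_left', mem_adjoint_graph_iff hT, ContinuousLinearMap.adjoint_inner_right]
  grind

end Relations

section Quotients

variable {H : Type*} [NormedAddCommGroup H] [InnerProductSpace ℂ H]

/-- The operator `B C⁻¹` for bounded operators `B` and `C`, with `C` injective: the linear relation
`{(C x, B x)}` is then the graph of an operator. -/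
noncomputable def quotientOp (B C : H →L[ℂ] H) : H →ₗ.[ℂ] H :=
  (LinearMap.range (C.toLinearMap.prod B.toLinearMap)).toLinearPMap

theorem mem_quotientOp_graph {B C : H →L[ℂ] H} (hC : Function.Injective C) {x y : H} :
    (x, y) ∈ (quotientOp B C).graph ↔ ∃ z, C z = x ∧ B z = y := by
  rw [quotientOp, Submodule.toLinearPMap_graph_eq]
  · simp [Prod.ext_iff]
  · rintro _ ⟨z, rfl⟩ hz
    obtain rfl := hC (hz.trans (map_zero C).symm)
    exact map_zero B

theorem quotientOp_domain (B C : H →L[ℂ] H) :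
    (quotientOp B C).domain = LinearMap.range C.toLinearMap := by
  rw [quotientOp, Submodule.toLinearPMap_domain, ← LinearMap.range_comp, LinearMap.fst_prod]

theorem quotientOp_apply {B C : H →L[ℂ] H} (hC : Function.Injective C) {z : H}
    (hz : C z ∈ (quotientOp B C).domain) : quotientOp B C ⟨C z, hz⟩ = B z :=
  (quotientOp B C).mem_graph_snd_inj ((quotientOp B C).mem_graph ⟨C z, hz⟩)
    ((mem_quotientOp_graph hC).2 ⟨z, rfl, rfl⟩) rfl

theorem denseRange_of_injective_of_nonneg [CompleteSpace H] {C : H →L[ℂ] H} (hC : 0 ≤ C)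
    (hinj : Function.Injective C) : DenseRange C := by
  have hrange : (LinearMap.range C.toLinearMap)ᗮ = ⊥ := by
    rw [ContinuousLinearMap.orthogonal_range, (IsSelfAdjoint.of_nonneg hC).adjoint_eq]
    exact LinearMap.ker_eq_bot.2 hinj
  exact Submodule.dense_iff_topologicalClosure_eq_top.2
    (Submodule.topologicalClosure_eq_top_iff.2 hrange)

theorem isPosSelfAdjoint_quotientOp [CompleteSpace H] {B C P Q : H →L[ℂ] H} (hB : 0 ≤ B)
    (hC : 0 ≤ C) (hinj : Function.Injective C) (hBC : Commute B C) (hP : Commute B P)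
    (hP' : Commute C P) (hQ : Commute B Q) (hQ' : Commute C Q) (h1 : P * C + Q * B = 1) :
    IsPosSelfAdjoint (quotientOp B C) := by
  have hdense : Dense ((quotientOp B C).domain : Set H) := by
    rw [quotientOp_domain]
    exact denseRange_of_injective_of_nonneg hC hinj
  have hsymm {A : H →L[ℂ] H} (hA : 0 ≤ A) (x y : H) : ⟪A x, y⟫_ℂ = ⟪x, A y⟫_ℂ :=
    (IsSelfAdjoint.of_nonneg hA).isSymmetric x y
  have hcomm {A A' : H →L[ℂ] H} (h : Commute A A') (x : H) : A (A' x) = A' (A x) :=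
    congr($h.eq x)
  have hone (x : H) : P (C x) + Q (B x) = x := congr($h1 x)
  refine ⟨hdense, LinearPMap.eq_of_eq_graph ?_, ?_⟩
  · ext ⟨x, y⟩
    have hadj : (x, y) ∈ (quotientOp B C).adjoint.graph ↔ B x = C y := by
      simp only [mem_adjoint_graph_iff hdense, mem_quotientOp_graph hinj]
      refine ⟨fun h => ext_inner_left ℂ fun z => ?_, ?_⟩
      · simpa only [hsymm hB, hsymm hC] using h _ _ ⟨z, rfl, rfl⟩
      · rintro h _ _ ⟨z, rfl, rfl⟩
        rw [hsymm hB, hsymm hC, h]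
    rw [hadj, mem_quotientOp_graph hinj]
    constructor
    · intro h
      refine ⟨P x + Q y, ?_, ?_⟩
      · rw [map_add, hcomm hP', hcomm hQ', ← h, hone]
      · rw [map_add, hcomm hP, hcomm hQ, h, hone]
    · rintro ⟨z, rfl, rfl⟩
      exact hcomm hBC z
  · rintro ⟨x, hx⟩
    obtain ⟨z, rfl⟩ : ∃ z, C z = x := by simpa [quotientOp_domain] using hx
    rw [quotientOp_apply hinj, hsymm hC]
    exact ((ContinuousLinearMap.nonneg_iff_isPositive _).1
      (hBC.symm.mul_nonneg hC hB)).inner_nonneg_right z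

theorem opComp_quotientOp_self {B C : H →L[ℂ] H} (hinj : Function.Injective C)
    (hBC : Commute B C) (h1 : C * C + B * B = 1) :
    opComp (quotientOp B C) (quotientOp B C) = quotientOp (B * B) (C * C) := by
  have hcomm (x : H) : B (C x) = C (B x) := congr($hBC.eq x)
  have hone (x : H) : C (C x) + B (B x) = x := congr($h1 x)
  refine LinearPMap.eq_of_eq_graph ?_
  ext ⟨x, y⟩
  simp only [mem_opComp_graph, mem_quotientOp_graph hinj,
    mem_quotientOp_graph (B := B * B) (C := C * C) (hinj.comp hinj), mul_apply_eq_comp]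
  constructor
  · rintro ⟨_, ⟨z, rfl, rfl⟩, w, hw, rfl⟩
    have hz : C (C z + B w) = z := by rw [map_add, ← hcomm, hw, hone]
    have hw' : B (C z + B w) = w := by rw [map_add, hcomm, ← hw, hone]
    exact ⟨C z + B w, by rw [hz], by rw [hw']⟩
  · rintro ⟨z, rfl, rfl⟩
    exact ⟨B (C z), ⟨C z, rfl, rfl⟩, B z, (hcomm z).symm, rfl⟩

end Quotients

section ClosedOperators

variable {H E M : Type*} [NormedAddCommGroup H] [InnerProductSpace ℂ H] [CompleteSpace H]
variable [NormedAddCommGroup E] [InnerProductSpace ℂ E] [CompleteSpace E]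
variable [NormedAddCommGroup M] [InnerProductSpace ℂ M] [CompleteSpace M]

theorem injective_sqrt {R : H →L[ℂ] H} (hR : 0 ≤ R) (hinj : Function.Injective R) :
    Function.Injective (CFC.sqrt R : H →L[ℂ] H) := by
  rw [← CFC.sqrt_mul_sqrt_self R hR] at hinj
  exact hinj.of_comp (g := (CFC.sqrt R : H →L[ℂ] H))

/-- The square root of `(1 - R) R⁻¹` is `√(1 - R) (√R)⁻¹`. -/
theorem DenseForm.isFormOf_quotientOp {t : DenseForm H} {R : H →L[ℂ] H} (hR : 0 ≤ R) (hR' : R ≤ 1)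
    (hinj : Function.Injective R) (hdom : t.dom = LinearMap.range (CFC.sqrt R).toLinearMap)
    (hform : ∀ u v hu hv, t.form ⟨CFC.sqrt R u, hu⟩ ⟨CFC.sqrt R v, hv⟩ =
      ⟪u, v⟫_ℂ - ⟪CFC.sqrt R u, CFC.sqrt R v⟫_ℂ) :
    t.IsFormOf (quotientOp (1 - R) R) := by
  have hRR : Commute R (1 - R) := (Commute.one_right R).sub_right (Commute.refl R)
  have hR1 : 0 ≤ 1 - R := sub_nonneg.2 hR'
  set C := CFC.sqrt R
  set B := CFC.sqrt (1 - R)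
  have hCC : C * C = R := CFC.sqrt_mul_sqrt_self R hR
  have hBB : B * B = 1 - R := CFC.sqrt_mul_sqrt_self (1 - R) hR1
  have hBC : Commute B C := (hRR.cfcₙ_nnreal NNReal.sqrt).symm.cfcₙ_nnreal NNReal.sqrt
  have hC : 0 ≤ C := CFC.sqrt_nonneg R
  have hB : 0 ≤ B := CFC.sqrt_nonneg (1 - R)
  have hCinj : Function.Injective C := injective_sqrt hR hinj
  have hCB : C * C + B * B = 1 := by rw [hCC, hBB, add_sub_cancel]
  refine ⟨isPosSelfAdjoint_quotientOp hR1 hR hinj hRR.symm (Commute.one_right _)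
      (Commute.one_right _) (Commute.one_right _) (Commute.one_right _) (by simp),
    quotientOp B C, isPosSelfAdjoint_quotientOp hB hC hCinj hBC hBC (Commute.refl C)
      (Commute.refl B) hBC.symm hCB, ?_, hdom.trans (quotientOp_domain B C).symm, ?_⟩
  · rw [opComp_quotientOp_self hCinj hBC hCB, hCC, hBB]
  · rintro ⟨x, hx⟩ ⟨y, hy⟩
    obtain ⟨u, rfl⟩ : ∃ u, C u = x := by simpa [hdom] using hx
    obtain ⟨v, rfl⟩ : ∃ v, C v = y := by simpa [hdom] using hy
    have hsymm {A : H →L[ℂ] H} (hA : 0 ≤ A) : ⟪A u, A v⟫_ℂ = ⟪u, (A * A) v⟫_ℂ :=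
      (IsSelfAdjoint.of_nonneg hA).isSymmetric u (A v)
    rw [hform, quotientOp_apply hCinj, quotientOp_apply hCinj, hsymm hB, hsymm hC,
      ← inner_sub_right, eq_sub_of_add_eq' hCB]
    rfl

theorem exists_linearIsometryEquiv_apply_eq {G : Type*} [AddCommGroup G] [Module ℂ G]
    {A : G →ₗ[ℂ] H} {B : G →ₗ[ℂ] E} (hA : DenseRange A) (hB : DenseRange B)
    (h : ∀ x, ‖B x‖ = ‖A x‖) : ∃ W : H ≃ₗᵢ[ℂ] E, ∀ x, W (A x) = B x :=
  ⟨(LinearEquiv.refl ℂ G).extendOfIsometry A B hA hB h,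
    LinearEquiv.extendOfIsometry_eq (LinearEquiv.refl ℂ G) A B hA hB h⟩

theorem injective_adjoint_of_denseRange {A : M →L[ℂ] H} (hA : DenseRange A) :
    Function.Injective A.adjoint := by
  refine LinearMap.ker_eq_bot.1 (A.orthogonal_range.symm.trans ?_)
  exact Submodule.topologicalClosure_eq_top_iff.1
    (Submodule.dense_iff_topologicalClosure_eq_top.1 hA)

theorem denseRange_adjoint_of_injective {A : M →L[ℂ] H} (hA : Function.Injective A) :
    DenseRange A.adjoint := by
  refine Submodule.dense_iff_topologicalClosure_eq_top.2
    (Submodule.topologicalClosure_eq_top_iff.2 (?_ : (LinearMap.range A.adjoint.toLinearMap)ᗮ = ⊥))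
  rw [ContinuousLinearMap.orthogonal_range, ContinuousLinearMap.adjoint_adjoint]
  exact LinearMap.ker_eq_bot.2 hA

theorem nonneg_comp_adjoint (A : M →L[ℂ] H) : 0 ≤ A ∘L A.adjoint :=
  (ContinuousLinearMap.nonneg_iff_isPositive _).2 A.isPositive_self_comp_adjoint

theorem comp_adjoint_le_one {A : M →L[ℂ] H} (hA : ‖A‖ ≤ 1) : A ∘L A.adjoint ≤ 1 := by
  rw [← CStarAlgebra.norm_le_one_iff_of_nonneg _ (nonneg_comp_adjoint A)]
  calc ‖A ∘L A.adjoint‖ ≤ ‖A‖ * ‖A.adjoint‖ := A.opNorm_comp_le _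
    _ = ‖A‖ * ‖A‖ := by rw [LinearIsometryEquiv.norm_map]
    _ ≤ 1 := mul_le_one₀ hA (norm_nonneg A) hA

theorem injective_comp_adjoint {A : M →L[ℂ] H} (hA : DenseRange A) :
    Function.Injective (A ∘L A.adjoint) := by
  refine LinearMap.ker_eq_bot.1 (A.ker_self_comp_adjoint.trans ?_)
  exact LinearMap.ker_eq_bot.2 (injective_adjoint_of_denseRange hA)

/-- The polar decomposition of `A*`, for an injective operator `A` with dense range. -/
theorem exists_sqrt_comp_adjoint_apply_eq {A : M →L[ℂ] H} (hA : Function.Injective A)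
    (hA' : DenseRange A) :
    ∃ W : M ≃ₗᵢ[ℂ] H, ∀ m, CFC.sqrt (A ∘L A.adjoint) (W m) = A m := by
  have hR := nonneg_comp_adjoint A
  set C := CFC.sqrt (A ∘L A.adjoint)
  have hC : 0 ≤ C := CFC.sqrt_nonneg _
  have hsymm (x y : H) : ⟪C x, y⟫_ℂ = ⟪x, C y⟫_ℂ := (IsSelfAdjoint.of_nonneg hC).isSymmetric x y
  have hCdense : DenseRange C :=
    denseRange_of_injective_of_nonneg hC (injective_sqrt hR (injective_comp_adjoint hA'))
  obtain ⟨W, hW⟩ := exists_linearIsometryEquiv_apply_eq (A := A.adjoint.toLinearMap)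
    (B := C.toLinearMap) (denseRange_adjoint_of_injective hA) hCdense fun x => by
      have hCC : C (C x) = A (A.adjoint x) := congr($(CFC.sqrt_mul_sqrt_self _ hR) x)
      rw [← sq_eq_sq₀ (norm_nonneg _) (norm_nonneg _), ← inner_self_eq_norm_sq (𝕜 := ℂ),
        ← inner_self_eq_norm_sq (𝕜 := ℂ)]
      simp only [ContinuousLinearMap.coe_coe]
      rw [hsymm, hCC, ContinuousLinearMap.adjoint_inner_left]
  refine ⟨W, fun m => ext_inner_left ℂ fun x => ?_⟩
  rw [← hsymm, ← ContinuousLinearMap.adjoint_inner_left]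
  exact (congrArg (⟪·, W m⟫_ℂ) (hW x)).symm.trans (W.inner_map_map _ _)

end ClosedOperators

section GraphProjection

variable {H E : Type*} [NormedAddCommGroup H] [InnerProductSpace ℂ H]
variable [NormedAddCommGroup E] [InnerProductSpace ℂ E]

/-- The first coordinate, as a contraction of the graph of `T`, with the graph inner product, into
`H`. -/
noncomputable def graphFst (T : H →ₗ.[ℂ] E) : l2Relation T.graph →L[ℂ] H :=
  (WithLp.fstL 2 ℂ H E).comp (l2Relation T.graph).subtypeL

theorem completeSpace_l2Relation [CompleteSpace H] [CompleteSpace E] {g : Submodule ℂ (H × E)}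
    (hg : IsClosed (g : Set (H × E))) : CompleteSpace (l2Relation g) :=
  (hg.preimage (WithLp.prodContinuousLinearEquiv 2 ℂ H E).continuous).completeSpace_coe

theorem injective_graphFst (T : H →ₗ.[ℂ] E) : Function.Injective (graphFst T) := by
  refine (injective_iff_map_eq_zero _).2 fun m hm => Subtype.ext ?_
  exact (WithLp.linearEquiv 2 ℂ (H × E)).injective
    (Prod.ext hm (T.graph_fst_eq_zero_snd m.2 hm))

theorem range_graphFst (T : H →ₗ.[ℂ] E) :
    LinearMap.range (graphFst T).toLinearMap = T.domain := by
  ext x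
  rw [LinearPMap.mem_domain_iff]
  exact ⟨fun ⟨m, hm⟩ => ⟨(m : WithLp 2 (H × E)).snd, hm ▸ m.2⟩,
    fun ⟨y, hy⟩ => ⟨⟨WithLp.toLp 2 (x, y), hy⟩, rfl⟩⟩

theorem norm_graphFst_le (T : H →ₗ.[ℂ] E) : ‖graphFst T‖ ≤ 1 :=
  ContinuousLinearMap.opNorm_le_bound _ zero_le_one fun m => by
    rw [one_mul]
    exact WithLp.norm_fst_le _ (m : WithLp 2 (H × E))

theorem inner_graphFst (T : H →ₗ.[ℂ] E) (m m' : l2Relation T.graph) :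
    ⟪(m : WithLp 2 (H × E)).snd, (m' : WithLp 2 (H × E)).snd⟫_ℂ =
      ⟪m, m'⟫_ℂ - ⟪graphFst T m, graphFst T m'⟫_ℂ :=
  (sub_eq_of_eq_add' (WithLp.prod_inner_apply _ _)).symm

variable [CompleteSpace H]

theorem adjoint_graphFst_apply_eq_iff {T : H →ₗ.[ℂ] E} (hT : Dense (T.domain : Set H))
    [CompleteSpace (l2Relation T.graph)] {u : H} {m : l2Relation T.graph} :
    (graphFst T).adjoint u = m ↔
      ((m : WithLp 2 (H × E)).snd, u - (m : WithLp 2 (H × E)).fst) ∈ T.adjoint.graph := by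
  rw [mem_adjoint_graph_iff hT, ext_iff_inner_left ℂ]
  simp only [ContinuousLinearMap.adjoint_inner_right, inner_sub_right, eq_sub_iff_add_eq']
  exact ⟨fun h a b hab => (h ⟨WithLp.toLp 2 (a, b), hab⟩).symm,
    fun h m' => (h _ _ m'.2).symm⟩

/-- `R = (1 + T*T)⁻¹` is the product of the graph projection with its adjoint. -/
theorem opComp_adjoint_self {T : H →ₗ.[ℂ] E} (hT : Dense (T.domain : Set H))
    [CompleteSpace (l2Relation T.graph)] :
    opComp T.adjoint T = quotientOp (1 - graphFst T ∘L (graphFst T).adjoint)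
      (graphFst T ∘L (graphFst T).adjoint) := by
  have hinj : Function.Injective (graphFst T ∘L (graphFst T).adjoint) := by
    refine injective_comp_adjoint ?_
    rwa [← range_graphFst] at hT
  refine LinearPMap.eq_of_eq_graph ?_
  ext ⟨x, z⟩
  rw [mem_opComp_graph, mem_quotientOp_graph hinj]
  constructor
  · rintro ⟨y, hxy, hyz⟩
    have hm : (graphFst T).adjoint (x + z) = ⟨WithLp.toLp 2 (x, y), hxy⟩ := by
      rw [adjoint_graphFst_apply_eq_iff hT]
      simpa using hyz
    have hx : graphFst T ((graphFst T).adjoint (x + z)) = x := by rw [hm]; rfl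
    exact ⟨x + z, hx, (congrArg (x + z - ·) hx).trans (add_sub_cancel_left x z)⟩
  · rintro ⟨u, rfl, rfl⟩
    exact ⟨_, ((graphFst T).adjoint u).2, (adjoint_graphFst_apply_eq_iff hT).1 rfl⟩

theorem DenseForm.ofOp_isFormOf [CompleteSpace E] {T : H →ₗ.[ℂ] E}
    (hT : Dense (T.domain : Set H)) (hcl : T.IsClosed) :
    (DenseForm.ofOp T hT).IsFormOf (opComp T.adjoint T) := by
  have := completeSpace_l2Relation hcl
  have hdense : DenseRange (graphFst T) := by rwa [← range_graphFst] at hT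
  obtain ⟨W, hW⟩ := exists_sqrt_comp_adjoint_apply_eq (injective_graphFst T) hdense
  rw [opComp_adjoint_self hT]
  refine DenseForm.isFormOf_quotientOp (nonneg_comp_adjoint _)
    (comp_adjoint_le_one (norm_graphFst_le T)) (injective_comp_adjoint hdense) ?_
    fun u v hu hv => ?_
  · refine (range_graphFst T).symm.trans (SetLike.coe_injective ?_)
    exact (congrArg Set.range (funext hW)).symm.trans (W.surjective.range_comp _)
  · obtain ⟨m, rfl⟩ := W.surjective u
    obtain ⟨m', rfl⟩ := W.surjective v
    have hgraph (m : l2Relation T.graph) (hm : graphFst T m ∈ T.domain) :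
        T ⟨graphFst T m, hm⟩ = (m : WithLp 2 (H × E)).snd :=
      T.mem_graph_snd_inj (T.mem_graph ⟨_, hm⟩) m.2 rfl
    rw [W.inner_map_map]
    simp only [hW] at hu hv ⊢
    rw [← inner_graphFst, ← hgraph m hu, ← hgraph m' hv]
    rfl

end GraphProjection

section SimonLebesgue

variable {H E V : Type*} [NormedAddCommGroup H] [InnerProductSpace ℂ H]
variable [NormedAddCommGroup E] [InnerProductSpace ℂ E] [AddCommGroup V] [Module ℂ V]

theorem adjoint_adjoint_of_isClosed [CompleteSpace H] [CompleteSpace E] {T : H →ₗ.[ℂ] E}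
    (hT : Dense (T.domain : Set H)) (hT' : Dense (T.adjoint.domain : Set E)) (hcl : T.IsClosed) :
    T.adjoint.adjoint = T := by
  refine LinearPMap.eq_of_eq_graph ?_
  rw [LinearPMap.adjoint_graph_eq_graph_adjoint hT', LinearPMap.adjoint_graph_eq_graph_adjoint hT,
    adjoint_adjoint_relation]
  exact hcl.submodule_topologicalClosure_eq

theorem mem_topologicalClosure_range_comp {F : Type*} [NormedAddCommGroup F] [NormedSpace ℂ F]
    {ι : V →ₗ[ℂ] H} {j : V →ₗ[ℂ] E} (f : E →L[ℂ] F) {x : H} {y : E}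
    (h : (x, y) ∈ (LinearMap.range (ι.prod j)).topologicalClosure) :
    (x, f y) ∈ (LinearMap.range (ι.prod (f.toLinearMap ∘ₗ j))).topologicalClosure :=
  map_mem_closure (f := fun p : H × E => (p.1, f p.2)) (by fun_prop) h
    (by rintro _ ⟨v, rfl⟩; exact ⟨v, rfl⟩)

variable {K : Submodule ℂ E} {ι : V →ₗ[ℂ] H} {j : V →ₗ[ℂ] E}

theorem inner_eq_inner_orthogonalProjectionOnto_add [K.HasOrthogonalProjection] (x y : E) :
    ⟪x, y⟫_ℂ = ⟪K.orthogonalProjectionOnto x, K.orthogonalProjectionOnto y⟫_ℂ +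
      ⟪Kᗮ.orthogonalProjectionOnto x, Kᗮ.orthogonalProjectionOnto y⟫_ℂ := by
  rw [Submodule.inner_orthogonalProjectionOnto_eq_of_mem_left,
    Submodule.inner_orthogonalProjectionOnto_eq_of_mem_left, ← inner_add_left]
  exact congrArg (⟪·, y⟫_ℂ) (K.starProjection_add_starProjection_orthogonal x).symm

variable [CompleteSpace K]

theorem graph_eq_topologicalClosure_range {T : H →ₗ.[ℂ] K}
    (hgraph : ∀ x (y : K), (x, y) ∈ T.graph ↔
      (x, (y : E)) ∈ (LinearMap.range (ι.prod j)).topologicalClosure)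
    (hproj : ∀ v, (ι v, K.orthogonalProjectionOnto (j v)) ∈ T.graph) :
    T.graph = (LinearMap.range
      (ι.prod (K.orthogonalProjectionOnto.toLinearMap ∘ₗ j))).topologicalClosure := by
  have hcl : IsClosed (T.graph : Set (H × K)) := by
    have : (T.graph : Set (H × K)) = (fun p : H × K => (p.1, (p.2 : E))) ⁻¹'
        ((LinearMap.range (ι.prod j)).topologicalClosure : Set (H × E)) :=
      Set.ext fun p => hgraph p.1 p.2
    rw [this]
    exact (Submodule.isClosed_topologicalClosure _).preimage (by fun_prop)
  refine le_antisymm ?_ (Submodule.topologicalClosure_minimal _ ?_ hcl)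
  · rintro ⟨x, y⟩ h
    simpa only [Submodule.orthogonalProjectionOnto_mem_subspace_eq_self] using
      mem_topologicalClosure_range_comp K.orthogonalProjectionOnto ((hgraph x y).1 h)
  · rintro _ ⟨v, rfl⟩
    exact hproj v

/-- The form of the `Kᗮ`-part is singular because the closure of
`{(ι v, Kᗮ.orthogonalProjectionOnto (j v))}` contains `(x, 0)` for every `x`. -/
theorem isSimonLebesgue_ofMap [CompleteSpace H] (hι : DenseRange ι)
    (hcloseable : IsCloseable ι (PSForm.ofMap (K.orthogonalProjectionOnto.toLinearMap ∘ₗ j)))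
    (hproj : ∀ v, (ι v, (K.orthogonalProjectionOnto (j v) : E)) ∈
      (LinearMap.range (ι.prod j)).topologicalClosure) :
    IsSimonLebesgue ι (PSForm.ofMap j)
      (PSForm.ofMap (K.orthogonalProjectionOnto.toLinearMap ∘ₗ j))
      (PSForm.ofMap (Kᗮ.orthogonalProjectionOnto.toLinearMap ∘ₗ j)) := by
  refine ⟨fun v w => inner_eq_inner_orthogonalProjectionOnto_add _ _, hcloseable,
    fun p hp hle => ?_, fun p hp hle x y => ?_⟩
  · obtain ⟨hdom, -⟩ := DenseForm.le_iff.1 hle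
    refine DenseForm.le_iff.2 ⟨hdom, fun v => ?_⟩
    rw [PSForm.seminorm_ofMap]
    exact hp.seminorm_le hle (hdom v) (hproj v)
  · have hzero (x : H) : (x, (0 : Kᗮ)) ∈ (LinearMap.range
        (ι.prod (Kᗮ.orthogonalProjectionOnto.toLinearMap ∘ₗ j))).topologicalClosure := by
      refine hι.induction_on x
        ((Submodule.isClosed_topologicalClosure _).preimage (by fun_prop)) fun v => ?_
      simpa only [Submodule.orthogonalProjectionOnto_orthogonal_apply_eq_zero
        (Submodule.coe_mem _)] using
        mem_topologicalClosure_range_comp Kᗮ.orthogonalProjectionOnto (hproj v)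
    have hseminorm (x : p.dom) : p.form.seminorm x = 0 :=
      le_antisymm ((hp.seminorm_le hle x.2 (hzero x)).trans_eq norm_zero) (apply_nonneg _ x)
    simp [PSForm.apply_eq_sum_seminorm_sq, hseminorm]

end SimonLebesgue

section ClosedRestriction

variable {H E : Type*} [NormedAddCommGroup H] [InnerProductSpace ℂ H]
variable [NormedAddCommGroup E] [InnerProductSpace ℂ E]
variable {K : Submodule ℂ E} {e : K →ₗ.[ℂ] H} {g : Submodule ℂ (H × E)}

theorem mem_adjoint_range_prod_iff {V : Type*} [AddCommGroup V] [Module ℂ V] {ι : V →ₗ[ℂ] H}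
    {j : V →ₗ[ℂ] E} {x : E} {y : H} :
    (x, y) ∈ (LinearMap.range (ι.prod j)).adjoint ↔ ∀ v, ⟪j v, x⟫_ℂ = ⟪ι v, y⟫_ℂ := by
  rw [Submodule.mem_adjoint_iff]
  refine ⟨fun h v => sub_eq_zero.1 (h _ _ ⟨v, rfl⟩), ?_⟩
  rintro h _ _ ⟨v, hv⟩
  obtain ⟨rfl, rfl⟩ := Prod.mk.inj hv
  exact sub_eq_zero.2 (h v)

theorem isClosed_adjoint_relation (g : Submodule ℂ (H × E)) :
    IsClosed (g.adjoint : Set (E × H)) := by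
  have : (g.adjoint : Set (E × H)) =
      ⋂ p ∈ g, {w | ⟪p.2, w.1⟫_ℂ - ⟪p.1, w.2⟫_ℂ = 0} := by
    ext w
    simp [Submodule.mem_adjoint_iff]
  rw [this]
  exact isClosed_biInter fun p _ => isClosed_eq (by fun_prop) (by fun_prop)

theorem isClosed_of_mem_graph_iff
    (hgraph : ∀ (x : K) y, (x, y) ∈ e.graph ↔ ((x : E), y) ∈ g.adjoint) : e.IsClosed := by
  have : (e.graph : Set (K × H)) = (fun p => ((p.1 : E), p.2)) ⁻¹' (g.adjoint : Set (E × H)) :=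
    Set.ext fun p => hgraph p.1 p.2
  rw [LinearPMap.IsClosed, this]
  exact (isClosed_adjoint_relation g).preimage (by fun_prop)

theorem mem_adjoint_graph_iff_mem_topologicalClosure [CompleteSpace H] [CompleteSpace E]
    [CompleteSpace K] (he : Dense (e.domain : Set K))
    (hgraph : ∀ (x : K) y, (x, y) ∈ e.graph ↔ ((x : E), y) ∈ g.adjoint)
    (hK : ∀ x y, (x, y) ∈ g.adjoint → x ∈ K) {x : H} {y : K} :
    (x, y) ∈ e.adjoint.graph ↔ (x, (y : E)) ∈ g.topologicalClosure := by
  rw [mem_adjoint_graph_iff he, ← adjoint_adjoint_relation, Submodule.mem_adjoint_iff]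
  simp only [hgraph, sub_eq_zero]
  exact ⟨fun h a b hab => h ⟨a, hK a b hab⟩ b hab, fun h a b hab => h a b hab⟩

theorem prodMk_orthogonalProjectionOnto_mem_adjoint_graph [CompleteSpace K]
    (he : Dense (e.domain : Set K))
    (hgraph : ∀ (x : K) y, (x, y) ∈ e.graph ↔ ((x : E), y) ∈ g.adjoint) {a : H} {b : E}
    (hab : (a, b) ∈ g) : (a, K.orthogonalProjectionOnto b) ∈ e.adjoint.graph := by
  rw [mem_adjoint_graph_iff he]
  intro x y hxy
  have h := sub_eq_zero.1 ((g.mem_adjoint_iff _).1 ((hgraph x y).1 hxy) a b hab)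
  rw [Submodule.inner_orthogonalProjectionOnto_eq_of_mem_left, ← inner_conj_symm, ← h,
    inner_conj_symm]

theorem dense_adjoint_domain_of_mem_graph_iff {V : Type*} [CompleteSpace K] [AddCommGroup V]
    [Module ℂ V] {ι : V →ₗ[ℂ] H} {j : V →ₗ[ℂ] E} (hι : DenseRange ι)
    (he : Dense (e.domain : Set K))
    (hgraph : ∀ (x : K) y,
      (x, y) ∈ e.graph ↔ ((x : E), y) ∈ (LinearMap.range (ι.prod j)).adjoint) :
    Dense (e.adjoint.domain : Set H) := by
  refine hι.mono ?_
  rintro _ ⟨v, rfl⟩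
  exact LinearPMap.mem_domain_of_mem_graph
    (prodMk_orthogonalProjectionOnto_mem_adjoint_graph he hgraph ⟨v, rfl⟩)

end ClosedRestriction

section CauchySpaces

theorem eq_zero_of_apply_szego {φ : diskAlgebra →L[ℂ] ℂ} (h : ∀ z, φ (szego z) = 0) : φ = 0 := by
  by_contra hφ
  have hdense : DenseRange φ :=
    (LinearMap.surjective (f := φ.toLinearMap) fun h0 =>
      hφ (ContinuousLinearMap.coe_injective h0)).denseRange
  exact one_ne_zero (eq_zero_of_inner_szego φ hdense 1 fun z => by rw [h z, inner_zero_left])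

variable (μ lam : Measure circ) [IsFiniteMeasure μ] [IsFiniteMeasure lam]

/-- The map `a ↦ 𝒞_μ a` of the disk algebra into `ℋ⁺(μ)`. -/
noncomputable def toHPlus : diskAlgebra →L[ℂ] HPlus μ :=
  ((cauchy μ).toContinuousLinearEquiv : hardy μ →L[ℂ] HPlus μ).comp (toHardy μ)

theorem HPlus_apply (f : HPlus μ) (z : 𝔻) : f z = ⟪toHPlus μ (szego z), f⟫_ℂ := rfl

theorem denseRange_toHPlus : DenseRange (toHPlus μ) :=
  (cauchy μ).surjective.denseRange.comp (denseRange_toHardy μ) (cauchy μ).continuous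

theorem ofMap_toHPlus : PSForm.ofMap (toHPlus μ).toLinearMap = measureForm μ := by
  refine PSForm.ext fun a b => ?_
  change ⟪toL2 μ a, toL2 μ b⟫_ℂ = _
  rw [L2.inner_def, measureForm_apply]
  refine integral_congr_ae ?_
  filter_upwards [ContinuousMap.coeFn_toLp (p := 2) (𝕜 := ℂ) μ (boundary a),
    ContinuousMap.coeFn_toLp (p := 2) (𝕜 := ℂ) μ (boundary b)] with ζ ha hb
  exact (congrArg₂ (inner ℂ) ha hb).trans (RCLike.inner_apply' _ _)

variable {μ lam}

theorem coe_eq_coe_iff_inner_toHPlus {f : HPlus μ} {g : HPlus lam} :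
    (g : 𝔻 → ℂ) = f ↔ ∀ a, ⟪toHPlus μ a, f⟫_ℂ = ⟪toHPlus lam a, g⟫_ℂ := by
  refine ⟨fun h a => ?_, fun h => funext fun z => (h (szego z)).symm⟩
  have hφ : (innerSL ℂ f).comp (toHPlus μ) - (innerSL ℂ g).comp (toHPlus lam) = 0 := by
    refine eq_zero_of_apply_szego fun z => sub_eq_zero.2 ?_
    change ⟪f, toHPlus μ (szego z)⟫_ℂ = ⟪g, toHPlus lam (szego z)⟫_ℂ
    rw [← inner_conj_symm f, ← inner_conj_symm g, ← HPlus_apply, ← HPlus_apply, h]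
  have ha : ⟪f, toHPlus μ a⟫_ℂ = ⟪g, toHPlus lam a⟫_ℂ := sub_eq_zero.1 (DFunLike.congr_fun hφ a)
  rw [← inner_conj_symm, ha, inner_conj_symm]

theorem mem_adjoint_range_toHPlus_iff {f : HPlus μ} {g : HPlus lam} :
    (f, g) ∈ (LinearMap.range
      ((toHPlus lam).toLinearMap.prod (toHPlus μ).toLinearMap)).adjoint ↔ (g : 𝔻 → ℂ) = f := by
  rw [coe_eq_coe_iff_inner_toHPlus, mem_adjoint_range_prod_iff]
  rfl

variable (μ lam) in
/-- The relation `{(a, 𝒞_μ a) | a ∈ A(𝔻)}` between `H²(λ)` and `ℋ⁺(μ)`; it need not be the graph of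
an operator. -/
noncomputable def coreRelation : Submodule ℂ (hardy lam × HPlus μ) :=
  LinearMap.range ((toHardy lam).toLinearMap.prod (toHPlus μ).toLinearMap)

theorem mem_adjoint_coreRelation_iff {f : HPlus μ} {h : hardy lam} :
    (f, h) ∈ (coreRelation μ lam).adjoint ↔ (cauchy lam h : 𝔻 → ℂ) = f := by
  rw [coreRelation, coe_eq_coe_iff_inner_toHPlus, mem_adjoint_range_prod_iff]
  exact forall_congr' fun a => by rw [← (cauchy lam).inner_map_map]; rfl

theorem mem_embedding_graph_iff {f : interClosure μ lam} {g : HPlus lam} :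
    (f, g) ∈ (embedding μ lam).graph ↔ (g : 𝔻 → ℂ) = (f : HPlus μ) := by
  constructor
  · intro h
    obtain ⟨f, rfl, rfl⟩ := (embedding μ lam).mem_graph_iff.1 h
    exact funext (embedding_apply μ lam f)
  · intro h
    have hf : embedding μ lam ⟨f, g, h⟩ = g :=
      DFunLike.coe_injective ((funext (embedding_apply μ lam ⟨f, g, h⟩)).trans h.symm)
    exact hf ▸ (embedding μ lam).mem_graph ⟨f, g, h⟩

variable (μ lam)

theorem embedding_isClosed : (embedding μ lam).IsClosed :=
  isClosed_of_mem_graph_iff fun _ _ => mem_embedding_graph_iff.trans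
    mem_adjoint_range_toHPlus_iff.symm

/-- The operator `𝒞_λ* e` from the closure of `int(μ, λ)` into `H²(λ)`. -/
noncomputable def hardyEmbedding : interClosure μ lam →ₗ.[ℂ] hardy lam :=
  opComp
    (((cauchy lam).toContinuousLinearEquiv :
      hardy lam →L[ℂ] HPlus lam).adjoint.toLinearMap.toPMap ⊤)
    (embedding μ lam)

variable {μ lam}

theorem mem_hardyEmbedding_graph_iff {f : interClosure μ lam} {h : hardy lam} :
    (f, h) ∈ (hardyEmbedding μ lam).graph ↔ ((f : HPlus μ), h) ∈ (coreRelation μ lam).adjoint := by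
  rw [hardyEmbedding, mem_opComp_graph, mem_adjoint_coreRelation_iff,
    LinearIsometryEquiv.adjoint_eq_symm]
  simp only [mem_toPMap_top_graph, mem_embedding_graph_iff]
  exact ⟨fun ⟨g, hg, hgh⟩ => by rw [← (cauchy lam).symm_apply_eq.1 hgh, hg],
    fun hf => ⟨cauchy lam h, hf, (cauchy lam).symm_apply_apply h⟩⟩

theorem mem_interClosure_of_mem_adjoint {f : HPlus μ} {h : hardy lam}
    (hfh : (f, h) ∈ (coreRelation μ lam).adjoint) : f ∈ interClosure μ lam :=
  Submodule.le_topologicalClosure _ ⟨cauchy lam h, mem_adjoint_coreRelation_iff.1 hfh⟩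

variable (μ lam)

theorem dense_hardyEmbedding_domain :
    Dense ((hardyEmbedding μ lam).domain : Set (interClosure μ lam)) := by
  refine (dense_embedding_domain μ lam).mono fun f hf => ?_
  exact (mem_opComp_domain _ _ f).2 ⟨hf, trivial⟩

theorem dense_adjoint_hardyEmbedding_domain :
    Dense ((hardyEmbedding μ lam).adjoint.domain : Set (hardy lam)) :=
  dense_adjoint_domain_of_mem_graph_iff (ι := (toHardy lam).toLinearMap) (denseRange_toHardy lam)
    (dense_hardyEmbedding_domain μ lam) fun _ _ => mem_hardyEmbedding_graph_iff

theorem opD_eq : opD μ lam =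
    opComp (hardyEmbedding μ lam).adjoint.adjoint (hardyEmbedding μ lam).adjoint := by
  rw [adjoint_adjoint_of_isClosed (dense_hardyEmbedding_domain μ lam)
    (dense_adjoint_hardyEmbedding_domain μ lam)
    (isClosed_of_mem_graph_iff fun _ _ => mem_hardyEmbedding_graph_iff), hardyEmbedding,
    adjoint_opComp_toPMap (dense_embedding_domain μ lam), ContinuousLinearMap.adjoint_adjoint,
    opComp_assoc]
  rfl

theorem isFormOf_opD :
    (DenseForm.ofOp (hardyEmbedding μ lam).adjoint
      (dense_adjoint_hardyEmbedding_domain μ lam)).IsFormOf (opD μ lam) :=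
  opD_eq μ lam ▸ DenseForm.ofOp_isFormOf _
    (LinearPMap.adjoint_isClosed (dense_hardyEmbedding_domain μ lam))

/-- The absolutely continuous part of `q_μ` with respect to `H²(λ)`: the form of the projections of
the `𝒞_μ a` onto the closure of `int(μ, λ)`. -/
noncomputable def acForm : PSForm diskAlgebra :=
  PSForm.ofMap ((interClosure μ lam).orthogonalProjectionOnto.toLinearMap ∘ₗ
    (toHPlus μ).toLinearMap)

/-- The singular part of `q_μ` with respect to `H²(λ)`: the form of the projections of the `𝒞_μ a`
onto the orthogonal complement of `int(μ, λ)`. -/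
noncomputable def singularForm : PSForm diskAlgebra :=
  PSForm.ofMap ((interClosure μ lam)ᗮ.orthogonalProjectionOnto.toLinearMap ∘ₗ
    (toHPlus μ).toLinearMap)

theorem mem_adjoint_hardyEmbedding_graph_iff {h : hardy lam} {f : interClosure μ lam} :
    (h, f) ∈ (hardyEmbedding μ lam).adjoint.graph ↔
      (h, (f : HPlus μ)) ∈ (coreRelation μ lam).topologicalClosure :=
  mem_adjoint_graph_iff_mem_topologicalClosure (dense_hardyEmbedding_domain μ lam)
    (fun _ _ => mem_hardyEmbedding_graph_iff) fun _ _ => mem_interClosure_of_mem_adjoint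

theorem prodMk_toHardy_mem_adjoint_hardyEmbedding_graph (a : diskAlgebra) :
    (toHardy lam a, (interClosure μ lam).orthogonalProjectionOnto (toHPlus μ a)) ∈
      (hardyEmbedding μ lam).adjoint.graph :=
  prodMk_orthogonalProjectionOnto_mem_adjoint_graph (dense_hardyEmbedding_domain μ lam)
    (fun _ _ => mem_hardyEmbedding_graph_iff) ⟨a, rfl⟩

theorem isClosureOf_acForm :
    (DenseForm.ofOp (hardyEmbedding μ lam).adjoint
      (dense_adjoint_hardyEmbedding_domain μ lam)).IsClosureOf (toHardy lam).toLinearMap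
        (acForm μ lam) :=
  DenseForm.ofOp_isClosureOf _ (graph_eq_topologicalClosure_range
    (fun _ _ => mem_adjoint_hardyEmbedding_graph_iff μ lam)
    (prodMk_toHardy_mem_adjoint_hardyEmbedding_graph μ lam))

theorem isSimonLebesgue_measureForm :
    IsSimonLebesgue (toHardy lam).toLinearMap (measureForm μ) (acForm μ lam)
      (singularForm μ lam) := by
  rw [← ofMap_toHPlus]
  exact isSimonLebesgue_ofMap (denseRange_toHardy lam)
    ⟨_, (isClosureOf_acForm μ lam).1, (isClosureOf_acForm μ lam).2.1⟩ fun a =>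
    (mem_adjoint_hardyEmbedding_graph_iff μ lam).1
      (prodMk_toHardy_mem_adjoint_hardyEmbedding_graph μ lam a)

/-- The projection onto `K` carries `𝒞_μ k_z` to the reproducing kernel of `K` at `z`. -/
theorem exists_unitary_formHPlus (K : Submodule ℂ (HPlus μ)) [CompleteSpace K]
    (hq : ∀ a, PSForm.ofMap (K.orthogonalProjectionOnto.toLinearMap ∘ₗ (toHPlus μ).toLinearMap) a a
      ≤ measureForm μ a a) :
    ∃ U : FormHPlus _ μ hq ≃ₗᵢ[ℂ] K, ∀ f (z : 𝔻), (U f : HPlus μ) z = f z := by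
  let j := K.orthogonalProjectionOnto.toLinearMap ∘ₗ (toHPlus μ).toLinearMap
  have hP : Function.Surjective K.orthogonalProjectionOnto := fun x =>
    ⟨x, Submodule.orthogonalProjectionOnto_mem_subspace_eq_self x⟩
  have hj : DenseRange j :=
    hP.denseRange.comp (denseRange_toHPlus μ) K.orthogonalProjectionOnto.continuous
  have hnorm (a : diskAlgebra) : ‖j a‖ = ‖toH2 (PSForm.ofMap j) a‖ := by
    rw [@norm_eq_sqrt_re_inner ℂ, @norm_eq_sqrt_re_inner ℂ, inner_toH2, PSForm.ofMap_apply]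
  obtain ⟨U, hU⟩ := exists_linearIsometryEquiv_apply_eq
    (UniformSpace.Completion.denseRange_coe (α := PreH2 (PSForm.ofMap j))) hj hnorm
  refine ⟨(formCauchy _ μ hq).symm.trans U, fun f z => ?_⟩
  obtain ⟨h, rfl⟩ := (formCauchy _ μ hq).surjective f
  calc ((U h : K) : HPlus μ) z
      = ⟪toHPlus μ (szego z), ((U h : K) : HPlus μ)⟫_ℂ := rfl
    _ = ⟪j (szego z), U h⟫_ℂ :=
      (Submodule.inner_orthogonalProjectionOnto_eq_of_mem_right (U h) _).symm
    _ = ⟪toH2 (PSForm.ofMap j) (szego z), h⟫_ℂ := by rw [← hU, U.inner_map_map]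
    _ = formCauchy _ μ hq h z := rfl

end CauchySpaces

end CauchyForms

theorem theorem5p10 (μ lam : Measure circ) [IsFiniteMeasure μ] [IsFiniteMeasure lam] :
    (∃! p : PSForm diskAlgebra × PSForm diskAlgebra,
      IsSimonLebesgue (toHardy lam).toLinearMap (measureForm μ) p.1 p.2) ∧
    ∀ (qac qs : PSForm diskAlgebra)
      (h : IsSimonLebesgue (toHardy lam).toLinearMap (measureForm μ) qac qs),
      (∃ U : FormHPlus qac μ h.ac_le ≃ₗᵢ[ℂ] interClosure μ lam,
        ∀ (f : FormHPlus qac μ h.ac_le) (z : 𝔻), (U f : HPlus μ) z = f z) ∧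
      (embedding μ lam).IsClosed ∧
      ∃ t : DenseForm (hardy lam),
        t.IsClosureOf (toHardy lam).toLinearMap qac ∧ t.IsFormOf (opD μ lam) := by
  have hSL := isSimonLebesgue_measureForm μ lam
  refine ⟨⟨(_, _), hSL, fun p hp => Prod.ext (hp.unique hSL).1 (hp.unique hSL).2⟩,
    fun qac qs h => ?_⟩
  obtain ⟨rfl, rfl⟩ := h.unique hSL
  exact ⟨exists_unitary_formHPlus μ _ h.ac_le, embedding_isClosed μ lam, _,
    isClosureOf_acForm μ lam, isFormOf_opD μ lam⟩
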